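/- A sunflower with $s$ petals is a family of $s$ distinct sets $F_1,\dots,F_s$ such that $F_i\cap F_j=\bigcap_{u=1}^s F_u$ for all distinct $i,j$; the set $\bigcap_{u=1}^s F_u$ is its core. Let $\mathcal C$ be a finite simplicial complex of rank at least $n$, that is, every inclusion-maximal face of $\mathcal C$ has at least $n$ elements. For an integer $h$ let $\mathcal C^{(h)}$ be the family of faces of size $h$. For families $\mathcal F,\mathcal T$ of sets and a set $T$ let $\mathcal F[\mathcal T]=\{F\in\mathcal F: T'\subseteq F\text{ for some }T'\in\mathcal T\}$ and $\mathcal F(T)=\{F\setminus T: F\in\mathcal F,\ T\subseteq F\}$. Let $s\ge 2$ and $k\ge t\ge 2$ be integers with $$\frac nk\ \ge\ 2^{18}s(t+1)\log_2\frac nk\qquad\text{and}\qquad n\ \ge\ 2^{15}sk\log_2 k .$$ Suppose that $\mathcal F\subseteq\mathcal C^{(k)}$ contains no sunflower with $s$ petals and core of size at most $t-1$. Then there is a family $\mathcal T\subseteq\mathcal C^{(t)}$ that contains no sunflower with $s$ petals (with any core) such that $$|\mathcal F\setminus\mathcal F[\mathcal T]|\ \le\ (2^{14}s\log_2 t)^t\cdot\frac{2^{19}s(t+1)\log_2(n/k)}{n/k}\cdot\max_{T\in\mathcal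 C^{(t)}}|\mathcal C^{(k)}(T)| ,$$ and therefore also the same bound with $\max_{T\in\mathcal C^{(t)}}|\mathcal C(T)|$ in place of $\max_{T\in\mathcal C^{(t)}}|\mathcal C^{(k)}(T)|$. (A maximum over an empty family is read as $0$; this concerns only the complex without faces.) -/

import Mathlib

namespace SimplicialSunflower

/-- The sets in the family `P` form a sunflower with core `K`: `K` is the intersection of all
members of `P`, and any two distinct members of `P` intersect exactly in `K`.
The number of petals is `P.card`. -/
def IsSunflower {V : Type*} [DecidableEq V] (P : Finset (Finset V)) (K : Finset V) : Prop :=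
  (∀ x, x ∈ K ↔ ∀ A ∈ P, x ∈ A) ∧ ∀ A ∈ P, ∀ B ∈ P, A ≠ B → A ∩ B = K

/-- `F` contains a sunflower with `s` petals (and arbitrary core). -/
def ContainsSunflower {V : Type*} [DecidableEq V] (F : Finset (Finset V)) (s : ℕ) : Prop :=
  ∃ P ⊆ F, P.card = s ∧ ∃ K, IsSunflower P K

/-- `F` contains a sunflower with `s` petals and core of size at most `c`. -/
def ContainsSunflowerWithCoreLE {V : Type*} [DecidableEq V] (F : Finset (Finset V)) (s c : ℕ) :
    Prop :=
  ∃ P ⊆ F, P.card = s ∧ ∃ K, IsSunflower P K ∧ K.card ≤ c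

/-- `C` has rank at least `n`: every inclusion-maximal face has at least `n` elements. -/
def RankAtLeast {V : Type*} (C : PreAbstractSimplicialComplex V) (n : ℕ) : Prop :=
  ∀ A, Maximal (· ∈ C) A → n ≤ A.card

open Classical in
/-- The family of all faces of a complex on a finite ground set. -/
noncomputable def faceFamily {V : Type*} [Fintype V] (C : PreAbstractSimplicialComplex V) :
    Finset (Finset V) :=
  Finset.univ.filter (· ∈ C)

/-- The `k`-th layer `C^(k)`: the faces with exactly `k` elements. -/
noncomputable def layer {V : Type*} [Fintype V] (C : PreAbstractSimplicialComplex V) (k : ℕ) :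
    Finset (Finset V) :=
  (faceFamily C).filter (fun A => A.card = k)

/-- `F(T) = {A \ T : A ∈ F, T ⊆ A}`. -/
def link {V : Type*} [DecidableEq V] (F : Finset (Finset V)) (T : Finset V) :
    Finset (Finset V) :=
  (F.filter (fun A => T ⊆ A)).image (fun A => A \ T)

/-- `F[𝒯]`: the members of `F` that contain some member of `𝒯`. -/
def containing {V : Type*} [DecidableEq V] (F 𝒯 : Finset (Finset V)) : Finset (Finset V) :=
  F.filter (fun A => ∃ T ∈ 𝒯, T ⊆ A)

/-- The maximum of `|𝒜(T)|` over the `t`-element faces `T` of `C`. -/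
noncomputable def maxLink {V : Type*} [Fintype V] [DecidableEq V]
    (C : PreAbstractSimplicialComplex V) (t : ℕ) (𝒜 : Finset (Finset V)) : ℕ :=
  (layer C t).sup (fun T => (link 𝒜 T).card)

end SimplicialSunflower

set_option linter.unusedSectionVars false

/-! The proof combines spread approximation with a spread lemma for random colourings. Put `ρ = n /
k` and let `M` be the largest degree of a `t`-face in the `k`-th layer. Swapping one element of a
face for another shows that degrees in the layer drop by a factor `ρ` with each added element
(`mul_degree_insert_le`). A set of size `t + i` therefore has degree at most `M / ρ ^ i`.

The spread lemma (`card_colorings_avoiding_le`) says that, when the spread is large compared with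
the number of colours, a union of `L` random colour classes misses every member of a spread family
with probability at most `4 ^ j / 2 ^ L`, where members have size below `2 ^ j`. Consequently `s`
spread families have pairwise disjoint representatives.

Peeling off dense links covers `F`, up to a remainder, by families that are `ρ / 2`-spread around
cores of size at most `q`, about `(t + 1) log₂ ρ`. The remainder is dense in the link of a set
larger than `q`, which forces its size below `M / ρ`. Cores whose pairwise intersections equal a set
smaller than `t` would extend, via disjoint representatives, to a forbidden sunflower in `F`
(`coresAtLeast_of_isSpreadCore`).

The cores are then shrunk as far as this property allows. Irreducibility bounds the number of
members of size `t + i` by roughly `(s log t) ^ t (s q) ^ i` up to constants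
(`card_filter_card_le_of_irreducible`). Against the degree bound this is a geometric series, so the
members larger than `t` account for few faces. The members of size exactly `t` form the required
family. -/

namespace SimplicialSunflower

open Finset

/-! ### Fragments of a set family -/

section

variable {V : Type*} [DecidableEq V]

/-- `G` is `R`-spread: every set `X` lies in at most an `R ^ (-|X|)` fraction of the members. -/
def IsSpread (R : ℝ) (G : Finset (Finset V)) : Prop :=
  ∀ X : Finset V, R ^ X.card * ((G.filter (X ⊆ ·)).card : ℝ) ≤ G.card

/-- The least `j` such that all but a `2 ^ (-j-1)` fraction of the sets `A S`, `S ∈ G`, have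
fewer than `2 ^ j` elements. -/
noncomputable def level (G : Finset (Finset V)) (A : Finset V → Finset V) : ℕ :=
  sInf {j | 2 ^ (j + 1) * (G.filter (fun S => 2 ^ j ≤ (A S).card)).card ≤ G.card}

theorem level_set_nonempty (G : Finset (Finset V)) (A : Finset V → Finset V) :
    {j | 2 ^ (j + 1) * (G.filter (fun S => 2 ^ j ≤ (A S).card)).card ≤ G.card}.Nonempty := by
  refine ⟨G.sup (fun S => (A S).card), ?_⟩
  have : G.filter (fun S => 2 ^ (G.sup (fun S => (A S).card)) ≤ (A S).card) = ∅ := by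
    refine filter_eq_empty_iff.2 fun S hS h => ?_
    have h1 : (A S).card ≤ G.sup (fun S => (A S).card) :=
      le_sup (f := fun S => (A S).card) hS
    have h2 := (G.sup (fun S => (A S).card)).lt_two_pow_self
    omega
  simp [this]

theorem level_spec (G : Finset (Finset V)) (A : Finset V → Finset V) :
    2 ^ (level G A + 1) * (G.filter (fun S => 2 ^ level G A ≤ (A S).card)).card ≤ G.card :=
  Nat.sInf_mem (level_set_nonempty G A)

theorem level_le {G : Finset (Finset V)} {A : Finset V → Finset V} {j : ℕ}
    (h : 2 ^ (j + 1) * (G.filter (fun S => 2 ^ j ≤ (A S).card)).card ≤ G.card) :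
    level G A ≤ j :=
  Nat.sInf_le h

theorem level_mono {G : Finset (Finset V)} {A A' : Finset V → Finset V}
    (h : ∀ S ∈ G, A' S ⊆ A S) : level G A' ≤ level G A := by
  refine level_le (le_trans (Nat.mul_le_mul_left _ (card_le_card ?_)) (level_spec G A))
  intro S hS
  simp only [mem_filter] at hS ⊢
  exact ⟨hS.1, hS.2.trans (card_le_card (h S hS.1))⟩

/-- Level `0` means that at least half of the sets are empty. -/
theorem exists_eq_empty_of_level_eq_zero {G : Finset (Finset V)} {A : Finset V → Finset V}
    (hG : G.Nonempty) (h : level G A = 0) : ∃ S ∈ G, A S = ∅ := by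
  by_contra! hne
  have h1 := level_spec G A
  rw [h, filter_true_of_mem] at h1
  · have := hG.card_pos
    simp at h1
    omega
  · intro S hS
    simpa using (hne S hS).card_pos

/-- Minimality makes a fragment recoverable: it lies in every competing small set inside `W`
together with that fragment. The size threshold on competitors keeps the number of subsets of such a
set small. -/
theorem exists_fragment (G : Finset (Finset V)) (A : Finset V → Finset V) (W : Finset V) (j : ℕ) :
    ∃ A' : Finset V → Finset V, ∀ S ∈ G, A' S ⊆ A S ∧ ∃ S₀ ∈ G, A' S = A S₀ \ W ∧
      ((A S).card < 2 ^ j → (A S₀).card < 2 ^ j ∧ ∀ S₁ ∈ G, (A S₁).card < 2 ^ j →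
        A S₁ ⊆ W ∪ A S → (A' S).card ≤ (A S₁ \ W).card) := by
  have key : ∀ S ∈ G, ∃ B, B ⊆ A S ∧ ∃ S₀ ∈ G, B = A S₀ \ W ∧
      ((A S).card < 2 ^ j → (A S₀).card < 2 ^ j ∧ ∀ S₁ ∈ G, (A S₁).card < 2 ^ j →
        A S₁ ⊆ W ∪ A S → B.card ≤ (A S₁ \ W).card) := by
    intro S hS
    by_cases hj : (A S).card < 2 ^ j
    · obtain ⟨S₀, h₀, hmin⟩ := exists_min_image
        (G.filter fun S₁ => (A S₁).card < 2 ^ j ∧ A S₁ ⊆ W ∪ A S) (fun S₁ => (A S₁ \ W).card)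
        ⟨S, by simp [hS, hj, subset_union_right]⟩
      simp only [mem_filter] at h₀ hmin
      refine ⟨A S₀ \ W, ?_, S₀, h₀.1, rfl, fun _ => ⟨h₀.2.1, fun S₁ h₁ h₂ h₃ =>
        hmin S₁ ⟨h₁, h₂, h₃⟩⟩⟩
      intro x hx
      have := h₀.2.2 (mem_sdiff.1 hx).1
      simp only [mem_union, mem_sdiff] at this hx
      tauto
    · exact ⟨A S \ W, sdiff_subset, S, hS, rfl, fun h => absurd h hj⟩
  choose! B hB using key
  exact ⟨B, hB⟩

/-- Replaces every set `A S` by a smallest fragment `A S₀ \ W` with `A S₀ ⊆ W ∪ A S`. -/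
noncomputable def fragmentStep (G : Finset (Finset V)) (A : Finset V → Finset V) (W : Finset V) :
    Finset V → Finset V :=
  Classical.choose (exists_fragment G A W (level G A))

theorem fragmentStep_spec (G : Finset (Finset V)) (A : Finset V → Finset V) (W : Finset V) :
    ∀ S ∈ G, fragmentStep G A W S ⊆ A S ∧ ∃ S₀ ∈ G, fragmentStep G A W S = A S₀ \ W ∧
      ((A S).card < 2 ^ level G A → (A S₀).card < 2 ^ level G A ∧
        ∀ S₁ ∈ G, (A S₁).card < 2 ^ level G A →
          A S₁ ⊆ W ∪ A S → (fragmentStep G A W S).card ≤ (A S₁ \ W).card) :=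
  Classical.choose_spec (exists_fragment G A W (level G A))

/-- The fragments that are left after exposing the sets `W 0, …, W (l - 1)`. -/
noncomputable def fragments (G : Finset (Finset V)) (W : ℕ → Finset V) :
    ℕ → Finset V → Finset V
  | 0 => id
  | l + 1 => fragmentStep G (fragments G W l) (W l)

theorem fragments_subset (G : Finset (Finset V)) (W : ℕ → Finset V) (l : ℕ) :
    ∀ S ∈ G, fragments G W l S ⊆ S := by
  induction l with
  | zero => intro S _; exact Subset.rfl
  | succ l ih => intro S hS; exact ((fragmentStep_spec G _ (W l) S hS).1).trans (ih S hS)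

theorem fragments_disjoint (G : Finset (Finset V)) (W : ℕ → Finset V) (l : ℕ) :
    ∀ i < l, ∀ S ∈ G, Disjoint (fragments G W l S) (W i) := by
  induction l with
  | zero => intro i hi; omega
  | succ l ih =>
    intro i hi S hS
    obtain ⟨hsub, S₀, _, heq, _⟩ := fragmentStep_spec G (fragments G W l) (W l) S hS
    rcases Nat.lt_succ_iff_lt_or_eq.1 hi with h | rfl
    · exact disjoint_of_subset_left hsub (ih i h S hS)
    · change Disjoint (fragmentStep G (fragments G W i) (W i) S) (W i)
      rw [heq]
      exact sdiff_disjoint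

/-- Once some fragment is empty, the exposed union contains a member of `G`. -/
theorem exists_subset_fragments_union (G : Finset (Finset V)) (W : ℕ → Finset V) (l : ℕ) :
    ∀ S ∈ G, ∃ S₀ ∈ G, S₀ ⊆ fragments G W l S ∪ (range l).biUnion W := by
  induction l with
  | zero => intro S hS; exact ⟨S, hS, by simp [fragments]⟩
  | succ l ih =>
    intro S hS
    obtain ⟨_, S₀, h₀, heq, _⟩ := fragmentStep_spec G (fragments G W l) (W l) S hS
    obtain ⟨S₁, h₁, hsub⟩ := ih S₀ h₀
    refine ⟨S₁, h₁, fun x hx => ?_⟩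
    change x ∈ fragmentStep G (fragments G W l) (W l) S ∪ _
    rw [heq, range_add_one, biUnion_insert]
    have := hsub hx
    simp only [mem_union, mem_sdiff] at this ⊢
    tauto

theorem fragments_congr (G : Finset (Finset V)) {W W' : ℕ → Finset V} (l : ℕ)
    (h : ∀ i < l, W i = W' i) : fragments G W l = fragments G W' l := by
  induction l with
  | zero => rfl
  | succ l ih =>
    simp only [fragments]
    rw [ih fun i hi => h i (by omega), h l (by omega)]

/-! ### Random colourings and disjoint members of spread families -/

variable [Fintype V] {κ : Type*} [Fintype κ] [DecidableEq κ]

/-- The colour class of `c`. -/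
def colorClass (f : V → κ) (c : κ) : Finset V := univ.filter (f · = c)

theorem mem_colorClass {f : V → κ} {c : κ} {v : V} : v ∈ colorClass f c ↔ f v = c := by
  simp [colorClass]

/-- Recolours the elements of `D` with `c`. -/
def recolor (f : V → κ) (D : Finset V) (c : κ) : V → κ := fun v => if v ∈ D then c else f v

theorem colorClass_recolor_self (f : V → κ) (D : Finset V) (c : κ) :
    colorClass (recolor f D c) c = colorClass f c ∪ D := by
  ext v
  simp only [colorClass, recolor, mem_filter, mem_univ, true_and, mem_union]
  by_cases h : v ∈ D <;> simp [h]

theorem colorClass_recolor_of_disjoint (f : V → κ) {D : Finset V} {c c' : κ} (hc : c ≠ c')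
    (hD : Disjoint D (colorClass f c')) :
    colorClass (recolor f D c) c' = colorClass f c' := by
  ext v
  by_cases h : v ∈ D
  · have := Finset.disjoint_left.1 hD h
    rw [mem_colorClass] at this
    simp [mem_colorClass, recolor, h, hc, this]
  · simp [mem_colorClass, recolor, h]

theorem card_agree_off (g : V → κ) (D : Finset V) :
    (univ.filter (fun f : V → κ => ∀ v ∉ D, f v = g v)).card = Fintype.card κ ^ D.card := by
  have : univ.filter (fun f : V → κ => ∀ v ∉ D, f v = g v) =
      Fintype.piFinset (fun v => if v ∈ D then univ else {g v}) := by
    ext f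
    simp only [mem_filter, mem_univ, true_and, Fintype.mem_piFinset]
    refine forall_congr' fun v => ?_
    by_cases h : v ∈ D <;> simp [h]
  rw [this, Fintype.card_piFinset]
  have h2 : ∀ v, (if v ∈ D then (univ : Finset κ) else {g v}).card =
      if v ∈ D then Fintype.card κ else 1 := by
    intro v; split_ifs <;> simp
  simp_rw [h2]
  rw [prod_ite]
  simp

/-- Exposing a further colour class lowers the level, except for a quarter of the colourings. -/
theorem four_mul_card_level_stuck_le {R : ℝ} {G : Finset (Finset V)} (hG : G.Nonempty)
    (hR : IsSpread R G) (hκ : 64 * (Fintype.card κ : ℝ) ≤ R)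
    (Φ : (V → κ) → Finset V → Finset V) (c : κ)
    (hsub : ∀ f, ∀ S ∈ G, Φ f S ⊆ S)
    (hinv : ∀ f, ∀ S ∈ G, ∀ D ⊆ Φ f S, Φ (recolor f D c) = Φ f) (i : ℕ) :
    4 * (univ.filter (fun f => level G (Φ f) = i + 1 ∧
      level G (fragmentStep G (Φ f) (colorClass f c)) = i + 1)).card ≤
      (univ.filter (fun f => level G (Φ f) = i + 1)).card := by
  classical
  set 𝓕 := univ.filter (fun f => level G (Φ f) = i + 1) with h𝓕
  set 𝓑 := univ.filter (fun f => level G (Φ f) = i + 1 ∧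
      level G (fragmentStep G (Φ f) (colorClass f c)) = i + 1) with h𝓑
  set bad : (V → κ) → Finset (Finset V) := fun f => G.filter (fun S =>
    (Φ f S).card < 2 ^ (i + 1) ∧
      2 ^ i ≤ (fragmentStep G (Φ f) (colorClass f c) S).card) with hbad
  -- Since the new level is not `i`, more than `|G| / 2 ^ (i + 1)` new fragments have size at least
  -- `2 ^ i`; at most `|G| / 2 ^ (i + 2)` of the old ones reach `2 ^ (i + 1)`.
  have hbad_card : ∀ f ∈ 𝓑, G.card ≤ 2 ^ (i + 2) * (bad f).card := by
    intro f hf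
    simp only [h𝓑, mem_filter, mem_univ, true_and] at hf
    have h1 := level_spec G (Φ f)
    rw [hf.1] at h1
    have h2 : ¬ 2 ^ (i + 1) * (G.filter (fun S => 2 ^ i ≤
        (fragmentStep G (Φ f) (colorClass f c) S).card)).card ≤ G.card := by
      intro h
      have := level_le h
      omega
    have h3 : (G.filter (fun S => 2 ^ i ≤
        (fragmentStep G (Φ f) (colorClass f c) S).card)).card ≤
        (bad f).card + (G.filter (fun S => 2 ^ (i + 1) ≤ (Φ f S).card)).card := by
      refine le_trans (card_le_card ?_) (card_union_le _ _)
      intro S hS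
      simp only [hbad, mem_union, mem_filter] at hS ⊢
      by_cases h : (Φ f S).card < 2 ^ (i + 1)
      · exact Or.inl ⟨hS.1, h, hS.2⟩
      · exact Or.inr ⟨hS.1, by omega⟩
    have h4 := Nat.mul_le_mul_left (2 ^ (i + 2)) h3
    have h5 : 2 ^ (i + 2) = 2 * 2 ^ (i + 1) := by ring
    rw [mul_add] at h4
    rw [show i + 1 + 1 = i + 2 by ring] at h1
    rw [h5] at h4 h1 ⊢
    nlinarith
  -- `B g` is chosen from `g` alone, so a subset of it costs at most `2 ^ 2 ^ (i + 1)` choices once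
  -- `g` is known.
  have hcanon : ∀ g : V → κ, ∃ B : Finset V, B.card ≤ 2 ^ (i + 1) ∧
      ((∃ S ∈ G, (Φ g S).card < 2 ^ (i + 1) ∧ Φ g S ⊆ colorClass g c) →
        ∃ S ∈ G, B = Φ g S ∧ (Φ g S).card < 2 ^ (i + 1) ∧ Φ g S ⊆ colorClass g c) := by
    intro g
    by_cases h : ∃ S ∈ G, (Φ g S).card < 2 ^ (i + 1) ∧ Φ g S ⊆ colorClass g c
    · obtain ⟨S, hS, h1, h2⟩ := h
      exact ⟨Φ g S, h1.le, fun _ => ⟨S, hS, rfl, h1, h2⟩⟩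
    · exact ⟨∅, by simp, fun h' => absurd h' h⟩
  choose B hBcard hB using hcanon
  set codes : (V → κ) → Finset (Finset V) := fun g =>
    (B g).powerset.filter (fun D => 2 ^ i ≤ D.card) with hcodes
  set pairs := 𝓕.sigma bad with hpairs
  -- A bad pair `(f, S)` is encoded by the colouring `g` that gives its fragment `D` the colour `c`,
  -- and by `D` itself. The fragments of `f` and `g` agree, and minimality of `D` places it inside
  -- `B g`.
  have hcover : pairs ⊆ (𝓕.sigma codes).biUnion (fun p =>
      (univ.filter (fun f : V → κ => ∀ v ∉ p.2, f v = p.1 v)).sigma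
        (fun _ => G.filter (p.2 ⊆ ·))) := by
    rintro ⟨f, S⟩ hfS
    simp only [hpairs, hbad, h𝓕, mem_sigma, mem_filter, mem_univ, true_and] at hfS
    obtain ⟨hf, hS, hlt, hge⟩ := hfS
    obtain ⟨hDsub, S₀, hS₀, hD, hmin⟩ := fragmentStep_spec G (Φ f) (colorClass f c) S hS
    set D := fragmentStep G (Φ f) (colorClass f c) S with hDdef
    rw [hf] at hmin
    obtain ⟨hS₀lt, hmin⟩ := hmin hlt
    have hΦ : Φ (recolor f D c) = Φ f := hinv f S hS D hDsub
    obtain ⟨S₁, hS₁, hBeq, h1lt, h1sub⟩ := hB (recolor f D c) ⟨S₀, hS₀, by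
      rw [hΦ, colorClass_recolor_self]
      refine ⟨hS₀lt, fun x hx => ?_⟩
      rw [hD]
      simp only [mem_union, mem_sdiff]
      tauto⟩
    rw [hΦ] at hBeq h1lt h1sub
    rw [colorClass_recolor_self] at h1sub
    have hDB : D ⊆ B (recolor f D c) := by
      have hle := hmin S₁ hS₁ h1lt (h1sub.trans (union_subset_union_right hDsub))
      have hss : Φ f S₁ \ colorClass f c ⊆ D := by
        intro x hx
        have := h1sub (mem_sdiff.1 hx).1
        simp only [mem_union, mem_sdiff] at this hx
        tauto
      rw [hBeq, ← eq_of_subset_of_card_le hss hle]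
      exact sdiff_subset
    refine mem_biUnion.2 ⟨⟨recolor f D c, D⟩, ?_, ?_⟩
    · simp only [h𝓕, hcodes, mem_sigma, mem_filter, mem_univ, true_and, mem_powerset]
      exact ⟨by rw [hΦ, hf], hDB, hge⟩
    · simp only [mem_sigma, mem_filter, mem_univ, true_and]
      refine ⟨fun v hv => by simp [recolor, hv], hS, hDsub.trans (hsub f S hS)⟩
  -- Decoding recovers the colours on `D` in `|κ| ^ |D|` ways and `S ⊇ D` in at most `|G| / R ^ |D|`
  -- ways; `64 |κ| ≤ R` and `|D| ≥ 2 ^ i`.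
  have hterm : ∀ p ∈ 𝓕.sigma codes, ((64 : ℝ) ^ 2 ^ i) *
      (((univ.filter (fun f : V → κ => ∀ v ∉ p.2, f v = p.1 v)).sigma
        (fun _ => G.filter (p.2 ⊆ ·))).card : ℝ) ≤ G.card := by
    rintro ⟨g, D⟩ hp
    simp only [hcodes, mem_sigma, mem_filter] at hp
    rw [card_sigma, sum_const, card_agree_off, smul_eq_mul]
    push_cast
    calc (64 : ℝ) ^ 2 ^ i * ((Fintype.card κ : ℝ) ^ D.card * ((G.filter (D ⊆ ·)).card : ℝ))
        ≤ 64 ^ D.card * ((Fintype.card κ : ℝ) ^ D.card * ((G.filter (D ⊆ ·)).card : ℝ)) := by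
          gcongr
          · norm_num
          · exact hp.2.2
      _ = (64 * (Fintype.card κ : ℝ)) ^ D.card * ((G.filter (D ⊆ ·)).card : ℝ) := by
          rw [mul_pow]; ring
      _ ≤ R ^ D.card * ((G.filter (D ⊆ ·)).card : ℝ) := by gcongr
      _ ≤ G.card := hR D
  have hcodes_card : ∀ g, ((codes g).card : ℝ) ≤ 4 ^ 2 ^ i := by
    intro g
    have h1 : (codes g).card ≤ 2 ^ 2 ^ (i + 1) :=
      (card_filter_le _ _).trans (by
        rw [card_powerset]; exact Nat.pow_le_pow_right (by norm_num) (hBcard g))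
    have h2 : (2 : ℕ) ^ 2 ^ (i + 1) = 4 ^ 2 ^ i := by
      rw [pow_succ' 2 i, pow_mul]
      norm_num
    rw [h2] at h1
    exact_mod_cast h1
  have hpairs_card : (16 : ℝ) ^ 2 ^ i * pairs.card ≤ 𝓕.card * G.card := by
    have h1 : (64 : ℝ) ^ 2 ^ i * pairs.card ≤ ∑ p ∈ 𝓕.sigma codes, (G.card : ℝ) := by
      have h2 := (card_le_card hcover).trans card_biUnion_le
      have h3 : (pairs.card : ℝ) ≤ ∑ p ∈ 𝓕.sigma codes,
        (((univ.filter (fun f : V → κ => ∀ v ∉ p.2, f v = p.1 v)).sigma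
        (fun _ => G.filter (p.2 ⊆ ·))).card : ℝ) := by exact_mod_cast h2
      refine (mul_le_mul_of_nonneg_left h3 (by positivity)).trans ?_
      rw [mul_sum]
      exact sum_le_sum hterm
    rw [sum_const, nsmul_eq_mul, card_sigma 𝓕 codes] at h1
    rw [Nat.cast_sum] at h1
    have h4 : ∑ g ∈ 𝓕, ((codes g).card : ℝ) ≤ 𝓕.card * 4 ^ 2 ^ i := by
      refine (sum_le_sum fun g _ => hcodes_card g).trans ?_
      simp
    have h5 : (64 : ℝ) ^ 2 ^ i = 4 ^ 2 ^ i * 16 ^ 2 ^ i := by rw [← mul_pow]; norm_num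
    have h6 : (64 : ℝ) ^ 2 ^ i * pairs.card ≤ 𝓕.card * 4 ^ 2 ^ i * G.card :=
      h1.trans (by gcongr)
    rw [h5] at h6
    have h7 : (0 : ℝ) < 4 ^ 2 ^ i := by positivity
    refine le_of_mul_le_mul_left ?_ h7
    linarith
  have hlow : 𝓑.card * G.card ≤ 2 ^ (i + 2) * pairs.card := by
    have h𝓑𝓕 : 𝓑 ⊆ 𝓕 := fun f hf => by
      simp only [h𝓑, h𝓕, mem_filter] at hf ⊢
      exact ⟨hf.1, hf.2.1⟩
    rw [hpairs, card_sigma, mul_sum, ← smul_eq_mul, ← sum_const]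
    exact (sum_le_sum hbad_card).trans (sum_le_sum_of_subset h𝓑𝓕)
  have hpow : 4 * 2 ^ (i + 2) ≤ 16 ^ 2 ^ i := by
    have h1 : 4 * 2 ^ (i + 2) = 2 ^ (i + 4) := by ring
    have h2 : (16 : ℕ) ^ 2 ^ i = 2 ^ (4 * 2 ^ i) := by rw [pow_mul]; norm_num
    rw [h1, h2]
    refine Nat.pow_le_pow_right (by norm_num) ?_
    have := i.lt_two_pow_self
    omega
  have hGpos : (0 : ℝ) < G.card := by exact_mod_cast hG.card_pos
  have hlow' : (𝓑.card : ℝ) * G.card ≤ 2 ^ (i + 2) * pairs.card := by exact_mod_cast hlow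
  have hpow' : (4 : ℝ) * 2 ^ (i + 2) ≤ 16 ^ 2 ^ i := by exact_mod_cast hpow
  have : (4 : ℝ) * 𝓑.card ≤ 𝓕.card := by
    refine le_of_mul_le_mul_right ?_ hGpos
    calc (4 : ℝ) * 𝓑.card * G.card = 4 * (𝓑.card * G.card) := by ring
      _ ≤ 4 * (2 ^ (i + 2) * pairs.card) := by gcongr
      _ = 4 * 2 ^ (i + 2) * pairs.card := by ring
      _ ≤ 16 ^ 2 ^ i * pairs.card := by gcongr
      _ ≤ _ := hpairs_card
  exact_mod_cast this

/-- The potential of a level. -/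
def levelWeight (j : ℕ) : ℕ := if j = 0 then 0 else 4 ^ j

theorem levelWeight_mono : Monotone levelWeight := by
  intro a b h
  unfold levelWeight
  split_ifs
  · simp
  · simp
  · omega
  · exact Nat.pow_le_pow_right (by norm_num) h

/-- From level `i + 1` at most a quarter of the colourings keep weight `4 ^ (i + 1)`, and the others
fall to at most `4 ^ i`. The average is at most `2 * 4 ^ i`, half of the old weight. -/
theorem two_mul_sum_levelWeight_fragmentStep_le {R : ℝ} {G : Finset (Finset V)}
    (hG : G.Nonempty) (hR : IsSpread R G) (hκ : 64 * (Fintype.card κ : ℝ) ≤ R)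
    (Φ : (V → κ) → Finset V → Finset V) (c : κ)
    (hsub : ∀ f, ∀ S ∈ G, Φ f S ⊆ S)
    (hinv : ∀ f, ∀ S ∈ G, ∀ D ⊆ Φ f S, Φ (recolor f D c) = Φ f) :
    2 * ∑ f, levelWeight (level G (fragmentStep G (Φ f) (colorClass f c))) ≤
      ∑ f, levelWeight (level G (Φ f)) := by
  classical
  set lev : (V → κ) → ℕ := fun f => level G (Φ f) with hlev
  set lev' : (V → κ) → ℕ := fun f => level G (fragmentStep G (Φ f) (colorClass f c)) with hlev'
  have hle : ∀ f, lev' f ≤ lev f := fun f =>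
    level_mono fun S hS => (fragmentStep_spec G (Φ f) (colorClass f c) S hS).1
  have hmaps : ∀ f ∈ (univ : Finset (V → κ)), lev f ∈ univ.image lev := fun f _ =>
    mem_image_of_mem _ (mem_univ f)
  rw [← sum_fiberwise_of_maps_to hmaps, ← sum_fiberwise_of_maps_to hmaps, mul_sum]
  refine sum_le_sum fun j _ => ?_
  rcases j with _ | i
  · rw [sum_eq_zero]
    · simp
    · intro f hf
      have h1 := hle f
      rw [(mem_filter.1 hf).2] at h1
      change levelWeight (lev' f) = 0
      rw [Nat.le_zero.1 h1]
      rfl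
  · have hpt : ∀ f ∈ univ.filter (fun f => lev f = i + 1),
        levelWeight (lev' f) ≤ 4 ^ i + if lev' f = i + 1 then 4 ^ (i + 1) else 0 := by
      intro f hf
      have h1 := hle f
      rw [(mem_filter.1 hf).2] at h1
      split_ifs with h
      · rw [h]; simp [levelWeight]
      · refine (levelWeight_mono (show lev' f ≤ i by omega)).trans ?_
        unfold levelWeight
        split_ifs <;> simp
    have hcount := four_mul_card_level_stuck_le hG hR hκ Φ c hsub hinv i
    have hsum : ∑ f with lev f = i + 1, levelWeight (lev' f) ≤
        (univ.filter (fun f => lev f = i + 1)).card * 4 ^ i +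
        (univ.filter (fun f => lev f = i + 1 ∧ lev' f = i + 1)).card * 4 ^ (i + 1) := by
      refine (sum_le_sum hpt).trans ?_
      rw [sum_add_distrib, sum_const, smul_eq_mul, ← sum_filter, sum_const, smul_eq_mul,
        filter_filter]
    have hrhs : ∑ f with lev f = i + 1, levelWeight (lev f) =
        (univ.filter (fun f => lev f = i + 1)).card * 4 ^ (i + 1) := by
      rw [sum_congr rfl (g := fun _ => 4 ^ (i + 1)), sum_const, smul_eq_mul]
      intro f hf
      rw [(mem_filter.1 hf).2]
      simp [levelWeight]
    rw [hrhs]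
    refine (Nat.mul_le_mul_left 2 hsum).trans ?_
    change 4 * (univ.filter (fun f => lev f = i + 1 ∧ lev' f = i + 1)).card ≤
      (univ.filter (fun f => lev f = i + 1)).card at hcount
    have h4 : 4 ^ (i + 1) = 4 * 4 ^ i := by ring
    rw [h4]
    nlinarith [Nat.mul_le_mul_right (4 ^ i) hcount]

/-- A union of `L` colour classes of a random colouring contains a member of a spread family,
with failure probability at most `4 ^ j / 2 ^ L`. -/
theorem card_colorings_avoiding_le {R : ℝ} {G : Finset (Finset V)}
    (hG : G.Nonempty) (hR : IsSpread R G) (hκ : 64 * (Fintype.card κ : ℝ) ≤ R)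
    {j L : ℕ} (hj : ∀ S ∈ G, S.card < 2 ^ j) (c : ℕ → κ) (hc : Set.InjOn c (Set.Iio L)) :
    2 ^ L * (univ.filter (fun f : V → κ =>
      ¬ ∃ S ∈ G, ∀ v ∈ S, ∃ l < L, f v = c l)).card ≤
      4 ^ j * Fintype.card κ ^ Fintype.card V := by
  classical
  set Φ : ℕ → (V → κ) → Finset V → Finset V := fun l f =>
    fragments G (fun i => colorClass f (c i)) l with hΦ
  have hstep : ∀ l < L, 2 * ∑ f, levelWeight (level G (Φ (l + 1) f)) ≤
      ∑ f, levelWeight (level G (Φ l f)) := by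
    intro l hl
    refine two_mul_sum_levelWeight_fragmentStep_le hG hR hκ (Φ l) (c l)
      (fun f S hS => fragments_subset G _ l S hS) ?_
    -- Fragments avoid the classes already exposed, so recolouring part of one with the new colour
    -- leaves those classes, and hence all current fragments, unchanged.
    intro f S hS D hD
    refine fragments_congr G l fun i hi => ?_
    refine colorClass_recolor_of_disjoint f ?_ ?_
    · intro h
      have := hc (Set.mem_Iio.2 hl) (Set.mem_Iio.2 (hi.trans hl)) h
      omega
    · exact disjoint_of_subset_left hD (fragments_disjoint G _ l i hi S hS)
  have hiter : ∀ l ≤ L, 2 ^ l * ∑ f, levelWeight (level G (Φ l f)) ≤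
      ∑ f, levelWeight (level G (Φ 0 f)) := by
    intro l
    induction l with
    | zero => simp
    | succ l ih =>
      intro hl
      refine le_trans ?_ (ih (by omega))
      rw [pow_succ, mul_assoc]
      exact Nat.mul_le_mul_left _ (hstep l (by omega))
  have h0 : ∑ f, levelWeight (level G (Φ 0 f)) ≤ 4 ^ j * Fintype.card κ ^ Fintype.card V := by
    have hlev : ∀ f, levelWeight (level G (Φ 0 f)) ≤ 4 ^ j := by
      intro f
      have h1 : level G (Φ 0 f) ≤ j := by
        refine level_le ?_
        rw [filter_false_of_mem]
        · simp
        · intro S hS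
          simpa [hΦ, fragments] using hj S hS
      refine (levelWeight_mono h1).trans ?_
      unfold levelWeight
      split_ifs <;> simp
    refine (sum_le_sum fun f _ => hlev f).trans ?_
    simp [mul_comm]
  refine le_trans (Nat.mul_le_mul_left _ ?_) ((hiter L le_rfl).trans h0)
  rw [card_filter]
  refine sum_le_sum fun f _ => ?_
  by_cases hf : ∃ S ∈ G, ∀ v ∈ S, ∃ l < L, f v = c l
  · rw [if_neg (not_not.2 hf)]
    exact Nat.zero_le _
  · rw [if_pos hf]
    -- Failure forces a nonzero level, whose weight is at least `1`; the total weight thus bounds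
    -- the number of failures.
    have hne : level G (Φ L f) ≠ 0 := by
      intro h
      obtain ⟨S, hS, hemp⟩ := exists_eq_empty_of_level_eq_zero hG h
      obtain ⟨S₀, hS₀, hsub⟩ :=
        exists_subset_fragments_union G (fun i => colorClass f (c i)) L S hS
      refine hf ⟨S₀, hS₀, fun v hv => ?_⟩
      have := hsub hv
      change v ∈ Φ L f S ∪ _ at this
      rw [hemp, empty_union] at this
      simpa [colorClass] using this
    simp only [levelWeight, hne, if_false]
    exact Nat.one_le_pow _ _ (by norm_num)

/-- For some colouring with `m` colours, few of `m` spread families have no member inside their own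
colour class. -/
theorem exists_coloring_few_failures {R : ℝ} {m j L : ℕ} (hL : 0 < L)
    (G : Fin m → Finset (Finset V)) (hG : ∀ a, (G a).Nonempty) (hR : ∀ a, IsSpread R (G a))
    (hmR : 64 * ((m : ℝ) * L) ≤ R) (hj : ∀ a, ∀ S ∈ G a, S.card < 2 ^ j) (hm : 0 < m) :
    ∃ g : V → Fin m,
      2 ^ L * (univ.filter (fun a => ¬ ∃ S ∈ G a, ∀ v ∈ S, g v = a)).card ≤ 4 ^ j * m := by
  classical
  have : NeZero L := ⟨hL.ne'⟩
  have : NeZero m := ⟨hm.ne'⟩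
  -- With colours `Fin m × Fin L`, the family `G a` is tested on the `L` classes with first
  -- coordinate `a`; the first coordinate alone is the final colouring.
  set fails : (V → Fin m × Fin L) → Fin m → Prop := fun f a =>
    ¬ ∃ S ∈ G a, ∀ v ∈ S, ∃ l < L, f v = (a, Fin.ofNat L l) with hfails
  have hone : ∀ a, 2 ^ L * (univ.filter (fun f => fails f a)).card ≤
      4 ^ j * Fintype.card (Fin m × Fin L) ^ Fintype.card V := by
    intro a
    refine card_colorings_avoiding_le (hG a) (hR a) (by simpa using hmR) (hj a)
      (fun l => (a, Fin.ofNat L l)) ?_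
    intro x hx y hy hxy
    simp only [Prod.mk.injEq, true_and] at hxy
    have := congrArg Fin.val hxy
    simpa [Fin.ofNat, Nat.mod_eq_of_lt (Set.mem_Iio.1 hx),
      Nat.mod_eq_of_lt (Set.mem_Iio.1 hy)] using this
  by_contra hcon
  replace hcon := fun g => not_le.1 (not_exists.1 hcon g)
  have hbig : ∀ f : V → Fin m × Fin L,
      4 ^ j * m < 2 ^ L * (univ.filter (fun a => fails f a)).card := by
    intro f
    refine (hcon (fun v => (f v).1)).trans_le (Nat.mul_le_mul_left _ (card_le_card ?_))
    intro a ha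
    simp only [mem_filter, mem_univ, true_and, hfails] at ha ⊢
    rintro ⟨S, hS, h⟩
    refine ha ⟨S, hS, fun v hv => ?_⟩
    obtain ⟨l, _, hl⟩ := h v hv
    rw [hl]
  have hdouble : ∑ f, (univ.filter (fun a => fails f a)).card =
      ∑ a, (univ.filter (fun f => fails f a)).card := by
    simp_rw [card_filter]
    exact sum_comm
  have h1 : ∑ _f : V → Fin m × Fin L, 4 ^ j * m <
      ∑ f, 2 ^ L * (univ.filter (fun a => fails f a)).card :=
    sum_lt_sum_of_nonempty ⟨fun _ => (0, 0), mem_univ _⟩ fun f _ => hbig f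
  rw [← mul_sum univ _ (2 ^ L), hdouble, mul_sum] at h1
  have h2 := sum_le_sum fun a (_ : a ∈ univ) => hone a
  have h3 := h1.trans_le h2
  simp only [sum_const, card_univ, Fintype.card_pi, prod_const, smul_eq_mul,
    Fintype.card_fin] at h3
  nlinarith

/-- `s` spread families have pairwise disjoint representatives. -/
theorem exists_disjoint_representatives {R : ℝ} {s j L : ℕ} (hs : 0 < s)
    (G : Fin s → Finset (Finset V)) (hG : ∀ a, (G a).Nonempty) (hR : ∀ a, IsSpread R (G a))
    (hsR : 64 * ((s : ℝ) * L) ≤ R) (hj : ∀ a, ∀ S ∈ G a, S.card < 2 ^ j)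
    (hL : 4 ^ j * s < 2 ^ L) :
    ∃ B : Fin s → Finset V, (∀ a, B a ∈ G a) ∧ ∀ a b, a ≠ b → Disjoint (B a) (B b) := by
  classical
  have hL0 : 0 < L := by
    rcases Nat.eq_zero_or_pos L with rfl | h
    · have : 0 < 4 ^ j * s := by positivity
      simp at hL
      omega
    · exact h
  obtain ⟨g, hg⟩ := exists_coloring_few_failures hL0 G hG hR hsR hj hs
  have hempty : univ.filter (fun a => ¬ ∃ S ∈ G a, ∀ v ∈ S, g v = a) = ∅ := by
    by_contra hne
    have h1 := (nonempty_iff_ne_empty.2 hne).card_pos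
    have := Nat.mul_le_mul_left (2 ^ L) h1
    omega
  have hall : ∀ a, ∃ S ∈ G a, ∀ v ∈ S, g v = a := by
    intro a
    by_contra h
    have : a ∈ univ.filter (fun a => ¬ ∃ S ∈ G a, ∀ v ∈ S, g v = a) := by simpa using h
    rw [hempty] at this
    simp at this
  choose B hB hB' using hall
  refine ⟨B, hB, fun a b hab => Finset.disjoint_left.2 fun v hva hvb => hab ?_⟩
  rw [← hB' a v hva, ← hB' b v hvb]

/-- A spread family contains `s` pairwise disjoint members. -/
theorem exists_disjoint_members {R : ℝ} {s j L : ℕ} (hs : 0 < s)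
    (G : Finset (Finset V)) (hG : G.Nonempty) (hR : IsSpread R G)
    (hsR : 128 * ((s : ℝ) * L) ≤ R) (hj : ∀ S ∈ G, S.card < 2 ^ j)
    (hL : 2 * 4 ^ j ≤ 2 ^ L) :
    ∃ B : Fin s → Finset V, (∀ a, B a ∈ G) ∧ ∀ a b, a ≠ b → Disjoint (B a) (B b) := by
  classical
  have hL0 : 0 < L := by
    rcases Nat.eq_zero_or_pos L with rfl | h
    · have : 0 < 4 ^ j := by positivity
      simp at hL
      omega
    · exact h
  -- With `2 * s` colours, half of them may fail. This keeps `L` independent of `s`.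
  obtain ⟨g, hg⟩ := exists_coloring_few_failures (m := 2 * s) hL0 (fun _ => G) (fun _ => hG)
    (fun _ => hR) (by push_cast; linarith) (fun _ => hj) (by omega)
  have hfail : (univ.filter (fun a => ¬ ∃ S ∈ G, ∀ v ∈ S, g v = a)).card ≤ s := by
    have h1 : 4 ^ j * (2 * s) ≤ 2 ^ L * s := by
      rw [← mul_assoc, mul_comm (4 ^ j) 2]; exact Nat.mul_le_mul_right s hL
    exact Nat.le_of_mul_le_mul_left (hg.trans h1) (by positivity)
  have hgood : s ≤ (univ.filter (fun a => ∃ S ∈ G, ∀ v ∈ S, g v = a)).card := by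
    have := card_filter_add_card_filter_not (s := (univ : Finset (Fin (2 * s))))
      (fun a => ∃ S ∈ G, ∀ v ∈ S, g v = a)
    rw [card_univ, Fintype.card_fin] at this
    omega
  obtain ⟨e⟩ : Nonempty (Fin s ↪ univ.filter (fun a => ∃ S ∈ G, ∀ v ∈ S, g v = a)) :=
    Function.Embedding.nonempty_of_card_le
      (by rw [Fintype.card_fin, Fintype.card_coe]; exact hgood)
  have hall : ∀ a : Fin s, ∃ S ∈ G, ∀ v ∈ S, g v = e a := fun a => (mem_filter.1 (e a).2).2
  choose B hB hB' using hall
  refine ⟨B, hB, fun a b hab => Finset.disjoint_left.2 fun v hva hvb => hab ?_⟩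
  refine e.injective (Subtype.ext ?_)
  rw [← hB' a v hva, ← hB' b v hvb]

end

/-! ### Links, and degrees in a complex of given rank -/

section

variable {V : Type*} [DecidableEq V]

theorem card_link (F : Finset (Finset V)) (T : Finset V) :
    (link F T).card = (F.filter (T ⊆ ·)).card := by
  refine card_image_of_injOn fun A hA B hB h => ?_
  have hA' := (mem_filter.1 hA).2
  have hB' := (mem_filter.1 hB).2
  rw [← sdiff_union_of_subset hA', ← sdiff_union_of_subset hB']
  exact congrArg (· ∪ T) h

theorem filter_subset_link (F : Finset (Finset V)) {T X : Finset V} (h : Disjoint X T) :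
    ((link F T).filter (X ⊆ ·)).card = (F.filter (X ∪ T ⊆ ·)).card := by
  have : (link F T).filter (X ⊆ ·) = (F.filter (X ∪ T ⊆ ·)).image (· \ T) := by
    ext B
    simp only [link, mem_filter, mem_image]
    constructor
    · rintro ⟨⟨A, ⟨hA, hT⟩, rfl⟩, hX⟩
      exact ⟨A, ⟨hA, union_subset (hX.trans sdiff_subset) hT⟩, rfl⟩
    · rintro ⟨A, ⟨hA, hXT⟩, rfl⟩
      refine ⟨⟨A, ⟨hA, subset_union_right.trans hXT⟩, rfl⟩, ?_⟩
      exact subset_sdiff.2 ⟨subset_union_left.trans hXT, h⟩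
  rw [this]
  refine card_image_of_injOn fun A hA B hB h' => ?_
  have hA' := subset_union_right.trans (mem_filter.1 hA).2
  have hB' := subset_union_right.trans (mem_filter.1 hB).2
  rw [← sdiff_union_of_subset hA', ← sdiff_union_of_subset hB']
  exact congrArg (· ∪ T) h'

/-- A link is spread as soon as the degrees in the family decay away from `T`. -/
theorem isSpread_link {R : ℝ} (F : Finset (Finset V)) (T : Finset V)
    (h : ∀ X, Disjoint X T →
      R ^ X.card * ((F.filter (X ∪ T ⊆ ·)).card : ℝ) ≤ (F.filter (T ⊆ ·)).card) :
    IsSpread R (link F T) := by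
  intro X
  by_cases hX : Disjoint X T
  · rw [filter_subset_link F hX, card_link]
    exact h X hX
  · have : (link F T).filter (X ⊆ ·) = ∅ := by
      refine filter_eq_empty_iff.2 fun B hB hXB => hX ?_
      obtain ⟨A, _, rfl⟩ := mem_image.1 hB
      exact disjoint_of_subset_left hXB sdiff_disjoint
    simp [this]

section Complex

variable [Fintype V] {C : PreAbstractSimplicialComplex V} {n k : ℕ}

theorem mem_layer {A : Finset V} : A ∈ layer C k ↔ A ∈ C ∧ A.card = k := by
  simp [layer, faceFamily]

theorem mem_of_subset_of_mem {A B : Finset V} (hA : A ∈ C) (hBA : B ⊆ A) (hB : B.Nonempty) :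
    B ∈ C :=
  (C.isRelLowerSet_faces hA).2 hBA hB

theorem exists_maximal_face {A : Finset V} (hA : A ∈ C) : ∃ M, Maximal (· ∈ C) M ∧ A ⊆ M := by
  obtain ⟨M, hAM, hM⟩ := (Set.toFinite {B | B ∈ C}).exists_le_maximal hA
  exact ⟨M, hM, hAM⟩

/-- Every element outside `A` of a maximal face above `A` extends `A` to a face. -/
theorem card_extensions_ge (hrank : RankAtLeast C n) {A : Finset V} (hA : A ∈ layer C k) :
    n ≤ k + (univ.filter (fun y => y ∉ A ∧ insert y A ∈ faceFamily C)).card := by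
  classical
  obtain ⟨hAC, hcard⟩ := mem_layer.1 hA
  obtain ⟨M, hM, hAM⟩ := exists_maximal_face hAC
  have h1 := hrank M hM
  have h2 : M \ A ⊆ univ.filter (fun y => y ∉ A ∧ insert y A ∈ faceFamily C) := by
    intro y hy
    rw [mem_sdiff] at hy
    simp only [mem_filter, mem_univ, true_and, faceFamily]
    exact ⟨hy.2, mem_of_subset_of_mem hM.1 (insert_subset hy.1 hAM) (insert_nonempty _ _)⟩
  have h3 := card_le_card h2
  rw [card_sdiff_of_subset hAM] at h3
  omega

/-- Adding an element to `X` lowers the degree of `X` in the `k`-th layer by a factor `k / n`. -/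
theorem mul_degree_insert_le (hrank : RankAtLeast C n) {X : Finset V} {x : V} (hx : x ∉ X) :
    n * ((layer C k).filter (insert x X ⊆ ·)).card ≤
      k * ((layer C k).filter (X ⊆ ·)).card := by
  classical
  set P := (layer C k).filter (insert x X ⊆ ·) with hP
  set Q := (layer C k).filter (fun B => X ⊆ B ∧ x ∉ B) with hQ
  have hsplit : ((layer C k).filter (X ⊆ ·)).card = P.card + Q.card := by
    rw [← card_filter_add_card_filter_not (s := (layer C k).filter (X ⊆ ·)) (fun B => x ∈ B),
      filter_filter, filter_filter]
    congr 2
    ext B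
    simp only [hP, mem_filter, insert_subset_iff]
    tauto
  set ext : Finset V → Finset V := fun A =>
    univ.filter (fun y => y ∉ A ∧ insert y A ∈ faceFamily C) with hext
  -- The swap `A ↦ A - x + y`, with `y` remembered, is injective.
  have hmap : ((P.sigma ext).card) ≤ (Q.sigma (fun B => B)).card := by
    refine card_le_card_of_injOn
      (fun p => (⟨insert p.2 (p.1.erase x), p.2⟩ : (_ : Finset V) × V)) ?_ ?_
    · rintro ⟨A, y⟩ hp
      simp only [hP, hext, coe_sigma, Set.mem_sigma_iff, mem_coe, mem_filter, mem_univ, true_and,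
        insert_subset_iff, mem_layer] at hp
      obtain ⟨⟨⟨hAC, hAk⟩, hxA, hXA⟩, hyA, hyC⟩ := hp
      have hxy : x ≠ y := fun h => hyA (h ▸ hxA)
      simp only [hQ, coe_sigma, Set.mem_sigma_iff, mem_coe, mem_filter, mem_layer]
      refine ⟨⟨⟨?_, ?_⟩, ?_, ?_⟩, mem_insert_self _ _⟩
      · refine mem_of_subset_of_mem (A := insert y A) ?_
          (insert_subset_insert _ (erase_subset _ _)) (insert_nonempty _ _)
        simpa [faceFamily] using hyC
      · rw [card_insert_of_notMem (fun h => hyA (mem_of_mem_erase h)), card_erase_of_mem hxA]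
        have := card_pos.2 ⟨x, hxA⟩
        omega
      · intro z hz
        exact mem_insert_of_mem (mem_erase.2 ⟨fun h => hx (h ▸ hz), hXA hz⟩)
      · simp [hxy]
    · rintro ⟨A, y⟩ hp ⟨A', y'⟩ hp' heq
      simp only [hP, hext, coe_sigma, Set.mem_sigma_iff, mem_coe, mem_filter, mem_univ, true_and,
        insert_subset_iff] at hp hp'
      simp only [Sigma.mk.injEq, heq_eq_eq] at heq
      obtain ⟨h1, rfl⟩ := heq
      have h2 : A.erase x = A'.erase x := by
        have := congrArg (fun B => B.erase y) h1
        simpa only [erase_insert (fun h => hp.2.1 (mem_of_mem_erase h)),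
          erase_insert (fun h => hp'.2.1 (mem_of_mem_erase h))] using this
      have h3 : A = A' := by
        rw [← insert_erase hp.1.2.1, ← insert_erase hp'.1.2.1, h2]
      subst h3
      rfl
  have hlow : P.card * n ≤ P.card * k + (P.sigma ext).card := by
    rw [card_sigma, ← smul_eq_mul, ← smul_eq_mul, ← sum_const, ← sum_const, ← sum_add_distrib]
    exact sum_le_sum fun A hA => card_extensions_ge hrank (mem_filter.1 hA).1
  have hup : (Q.sigma (fun B => B)).card = Q.card * k := by
    rw [card_sigma, sum_congr rfl (g := fun _ => k), sum_const, smul_eq_mul]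
    intro B hB
    exact (mem_layer.1 (mem_filter.1 hB).1).2
  rw [hsplit]
  nlinarith

theorem pow_mul_degree_le (hrank : RankAtLeast C n) {X Y : Finset V} (hXY : X ⊆ Y) :
    n ^ (Y.card - X.card) * ((layer C k).filter (Y ⊆ ·)).card ≤
      k ^ (Y.card - X.card) * ((layer C k).filter (X ⊆ ·)).card := by
  obtain ⟨Z, hZ, rfl⟩ : ∃ Z, Disjoint X Z ∧ X ∪ Z = Y :=
    ⟨Y \ X, disjoint_sdiff, union_sdiff_of_subset hXY⟩
  rw [card_union_of_disjoint hZ, Nat.add_sub_cancel_left]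
  clear hXY
  induction Z using Finset.induction_on with
  | empty => simp
  | insert z Z hz ih =>
    rw [disjoint_insert_right] at hZ
    have h1 := ih hZ.2
    have h2 := mul_degree_insert_le (k := k) hrank (X := X ∪ Z) (x := z) (by simp [hz, hZ.1])
    rw [union_insert, card_insert_of_notMem hz, pow_succ, pow_succ]
    calc n ^ Z.card * n * _ = n ^ Z.card * (n * _) := mul_assoc _ _ _
      _ ≤ n ^ Z.card * (k * _) := Nat.mul_le_mul_left _ h2
      _ = k * (n ^ Z.card * _) := by ring
      _ ≤ k * (k ^ Z.card * _) := Nat.mul_le_mul_left _ h1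
      _ = _ := by ring

end Complex

end

/-! ### Spread approximation -/

section

variable {V : Type*} [DecidableEq V]

theorem pow_mul_degree_le_maxLink [Fintype V] {C : PreAbstractSimplicialComplex V} {n k t : ℕ}
    (hrank : RankAtLeast C n) (hk : 0 < k) (ht : 0 < t) {Y : Finset V} (hY : t ≤ Y.card) :
    ((n : ℝ) / k) ^ (Y.card - t) * (((layer C k).filter (Y ⊆ ·)).card : ℝ) ≤
      maxLink C t (layer C k) := by
  rcases ((layer C k).filter (Y ⊆ ·)).eq_empty_or_nonempty with h | ⟨A, hA⟩
  · rw [h]; simp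
  · obtain ⟨T, hTY, hT⟩ := exists_subset_card_eq hY
    obtain ⟨hA, hYA⟩ := mem_filter.1 hA
    have hTC : T ∈ layer C t := mem_layer.2 ⟨mem_of_subset_of_mem (mem_layer.1 hA).1
      (hTY.trans hYA) (card_pos.1 (by omega)), hT⟩
    have h1 : ((layer C k).filter (T ⊆ ·)).card ≤ maxLink C t (layer C k) := by
      rw [← card_link]
      exact le_sup (f := fun T => (link (layer C k) T).card) hTC
    have h2 := pow_mul_degree_le (k := k) hrank hTY
    rw [hT] at h2
    have h3 := h2.trans (Nat.mul_le_mul_left _ h1)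
    have h4 : (n : ℝ) ^ (Y.card - t) * (((layer C k).filter (Y ⊆ ·)).card : ℝ) ≤
      (k : ℝ) ^ (Y.card - t) * maxLink C t (layer C k) := by exact_mod_cast h3
    have hk' : (0 : ℝ) < (k : ℝ) ^ (Y.card - t) := by positivity
    rw [div_pow, div_mul_eq_mul_div, div_le_iff₀ hk']
    linarith

/-- `S` is contained in all members of a subfamily of `F` that is `R`-spread outside of `S`. -/
def IsSpreadCore (R : ℝ) (F : Finset (Finset V)) (S : Finset V) : Prop :=
  ∃ H ⊆ F, H.Nonempty ∧ (∀ A ∈ H, S ⊆ A) ∧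
    ∀ X, Disjoint X S → R ^ X.card * ((H.filter (X ⊆ ·)).card : ℝ) ≤ H.card

/-- Sets of the family (repetitions allowed) with constant pairwise intersection `K` only exist
for `t ≤ |K|`. -/
def CoresAtLeast (s t : ℕ) (𝒮 : Finset (Finset V)) : Prop :=
  ∀ S : Fin s → Finset V, (∀ i, S i ∈ 𝒮) → ∀ K, (∀ i j, i ≠ j → S i ∩ S j = K) → t ≤ K.card

/-- Take `Y` of maximal size with the density inequality, which `∅` satisfies. A set violating
spreadness could be added to `Y`. -/
theorem exists_spread_link [Fintype V] {R : ℝ} (hR : 0 < R) {F : Finset (Finset V)}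
    (hF : F.Nonempty) :
    ∃ Y, (F.card : ℝ) ≤ R ^ Y.card * ((F.filter (Y ⊆ ·)).card : ℝ) ∧
      (F.filter (Y ⊆ ·)).Nonempty ∧ ∀ X, Disjoint X Y → R ^ X.card *
        (((F.filter (Y ⊆ ·)).filter (X ⊆ ·)).card : ℝ) ≤ (F.filter (Y ⊆ ·)).card := by
  classical
  obtain ⟨Y, hY, hmax⟩ := exists_max_image (univ.filter fun Y : Finset V =>
    (F.card : ℝ) ≤ R ^ Y.card * ((F.filter (Y ⊆ ·)).card : ℝ)) card ⟨∅, by simp⟩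
  simp only [mem_filter, mem_univ, true_and] at hY hmax
  refine ⟨Y, hY, ?_, fun X hX => ?_⟩
  · by_contra h
    rw [not_nonempty_iff_eq_empty.1 h] at hY
    have := hF.card_pos
    simp only [card_empty, Nat.cast_zero, mul_zero] at hY
    have h2 : (0 : ℝ) < F.card := by exact_mod_cast this
    linarith
  · rcases X.eq_empty_or_nonempty with rfl | hne
    · simp
    · have hcard : (X ∪ Y).card = X.card + Y.card := card_union_of_disjoint hX
      have h1 : ¬ (F.card : ℝ) ≤ R ^ (X ∪ Y).card * ((F.filter (X ∪ Y ⊆ ·)).card : ℝ) := by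
        intro h
        have := hmax _ h
        have := hne.card_pos
        omega
      have h2 : (F.filter (Y ⊆ ·)).filter (X ⊆ ·) = F.filter (X ∪ Y ⊆ ·) := by
        rw [filter_filter]
        ext A
        simp only [mem_filter, union_subset_iff]
        tauto
      rw [h2]
      rw [hcard, pow_add] at h1
      refine le_of_mul_le_mul_left ?_ (pow_pos hR Y.card)
      nlinarith

/-- Spread approximation: up to a remainder, `F` is covered by small spread cores. -/
theorem exists_spread_approximation [Fintype V] {R : ℝ} (hR : 0 < R) (q : ℕ)
    (F : Finset (Finset V)) :
    ∃ 𝒮 F' : Finset (Finset V), F' ⊆ F ∧ (∀ A ∈ F, A ∉ F' → ∃ S ∈ 𝒮, S ⊆ A) ∧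
      (∀ S ∈ 𝒮, S.card ≤ q ∧ IsSpreadCore R F S) ∧
      (F' = ∅ ∨ ∃ Y, q < Y.card ∧
        (F'.card : ℝ) ≤ R ^ Y.card * ((F'.filter (Y ⊆ ·)).card : ℝ)) := by
  induction F using Finset.strongInduction with
  | _ F ih =>
  rcases F.eq_empty_or_nonempty with rfl | hF
  · exact ⟨∅, ∅, by simp⟩
  obtain ⟨Y, hY, hne, hspread⟩ := exists_spread_link hR hF
  by_cases hq : q < Y.card
  -- Peeling stops at the first dense set larger than `q`; all that is left becomes the remainder.
  · exact ⟨∅, F, Subset.rfl, fun A hA h => absurd hA h, by simp, Or.inr ⟨Y, hq, hY⟩⟩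
  have hlt : F.filter (¬ Y ⊆ ·) ⊂ F := by
    obtain ⟨A, hA⟩ := hne
    obtain ⟨hAF, hYA⟩ := mem_filter.1 hA
    exact filter_ssubset.2 ⟨A, hAF, not_not.2 hYA⟩
  obtain ⟨𝒮, F', hF', hcov, hcore, hrem⟩ := ih _ hlt
  refine ⟨insert Y 𝒮, F', hF'.trans hlt.1, fun A hA hA' => ?_, fun S hS => ?_, hrem⟩
  · by_cases hYA : Y ⊆ A
    · exact ⟨Y, mem_insert_self _ _, hYA⟩
    · obtain ⟨S, hS, hSA⟩ := hcov A (mem_filter.2 ⟨hA, hYA⟩) hA'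
      exact ⟨S, mem_insert_of_mem hS, hSA⟩
  · rcases mem_insert.1 hS with rfl | hS
    · exact ⟨not_lt.1 hq, _, filter_subset _ _, hne, fun A hA => (mem_filter.1 hA).2, hspread⟩
    · obtain ⟨h1, H, hH, h2⟩ := hcore S hS
      exact ⟨h1, H, hH.trans hlt.1, h2⟩

/-- At least half of a family which is spread outside of `S` avoids a small set outside of `S`. -/
theorem card_le_two_mul_card_filter_inter_subset {R : ℝ} (hR : 0 < R) {H : Finset (Finset V)}
    {S : Finset V}
    (hspread : ∀ X, Disjoint X S → R ^ X.card * ((H.filter (X ⊆ ·)).card : ℝ) ≤ H.card)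
    {U : Finset V} (hU : 2 * (U.card : ℝ) ≤ R) :
    (H.card : ℝ) ≤ 2 * (H.filter (· ∩ U ⊆ S)).card := by
  have hbad : H.filter (¬ · ∩ U ⊆ S) ⊆ (U \ S).biUnion (fun y => H.filter ({y} ⊆ ·)) := by
    intro A hA
    obtain ⟨hAH, hAU⟩ := mem_filter.1 hA
    obtain ⟨y, hy, hyS⟩ := not_subset.1 hAU
    rw [mem_inter] at hy
    exact mem_biUnion.2 ⟨y, mem_sdiff.2 ⟨hy.2, hyS⟩, mem_filter.2 ⟨hAH, by simpa using hy.1⟩⟩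
  have h1 : ((H.filter (¬ · ∩ U ⊆ S)).card : ℝ) ≤
      ∑ y ∈ U \ S, ((H.filter ({y} ⊆ ·)).card : ℝ) := by
    exact_mod_cast (card_le_card hbad).trans card_biUnion_le
  have h2 : R * ((H.filter (¬ · ∩ U ⊆ S)).card : ℝ) ≤ U.card * H.card := by
    calc R * ((H.filter (¬ · ∩ U ⊆ S)).card : ℝ)
        ≤ R * ∑ y ∈ U \ S, ((H.filter ({y} ⊆ ·)).card : ℝ) := by gcongr
      _ = ∑ y ∈ U \ S, R * ((H.filter ({y} ⊆ ·)).card : ℝ) := mul_sum _ _ _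
      _ ≤ ∑ y ∈ U \ S, (H.card : ℝ) := by
          refine sum_le_sum fun y hy => ?_
          simpa using hspread {y} (disjoint_singleton_left.2 (mem_sdiff.1 hy).2)
      _ = (U \ S).card * H.card := by simp
      _ ≤ U.card * H.card := by gcongr; exact sdiff_subset
  have h3 : ((H.filter (· ∩ U ⊆ S)).card : ℝ) + ((H.filter (¬ · ∩ U ⊆ S)).card : ℝ) = H.card := by
    exact_mod_cast card_filter_add_card_filter_not (s := H) (· ∩ U ⊆ S)
  have h4 : R * ((H.filter (¬ · ∩ U ⊆ S)).card : ℝ) ≤ R * (H.card / 2) := by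
    refine h2.trans ?_
    have : (0 : ℝ) ≤ H.card := by positivity
    nlinarith
  have h5 := le_of_mul_le_mul_left h4 hR
  linarith

theorem containsSunflowerWithCoreLE_of_pairwise_inter {F : Finset (Finset V)} {s t : ℕ}
    (hs : 2 ≤ s) {A : Fin s → Finset V} (hA : ∀ i, A i ∈ F) {K : Finset V}
    (hK : ∀ i j, i ≠ j → A i ∩ A j = K) (hAK : ∀ i, A i ≠ K) (hKt : K.card ≤ t) :
    ContainsSunflowerWithCoreLE F s t := by
  have hinj : Function.Injective A := by
    intro i j hij
    by_contra hne
    have := hK i j hne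
    rw [← hij, inter_self] at this
    exact hAK i this
  refine ⟨univ.image A, image_subset_iff.2 fun i _ => hA i, ?_, K, ⟨fun x => ?_, ?_⟩, hKt⟩
  · rw [card_image_of_injective _ hinj, card_univ, Fintype.card_fin]
  · simp only [mem_image, mem_univ, true_and, forall_exists_index, forall_apply_eq_imp_iff]
    have h01 : (⟨0, by omega⟩ : Fin s) ≠ ⟨1, by omega⟩ := by simp
    constructor
    · intro hx i
      by_cases hi : i = ⟨0, by omega⟩
      · rw [← hK _ _ h01] at hx
        rw [hi]
        exact (mem_inter.1 hx).1
      · rw [← hK i _ hi] at hx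
        exact (mem_inter.1 hx).1
    · intro h
      rw [← hK _ _ h01]
      exact mem_inter.2 ⟨h _, h _⟩
  · simp only [mem_image, mem_univ, true_and, forall_exists_index, forall_apply_eq_imp_iff]
    intro i j hij
    exact hK i j fun h => hij (h ▸ rfl)

/-- Spread cores inherit from `F` the absence of sunflowers with small core. -/
theorem coresAtLeast_of_isSpreadCore [Fintype V] {R : ℝ} {s t k q j L : ℕ} (hs : 2 ≤ s)
    (ht : 0 < t) (htk : t ≤ k)
    {F : Finset (Finset V)} (hF : ∀ A ∈ F, A.card = k)
    (hfree : ¬ ContainsSunflowerWithCoreLE F s (t - 1)) {𝒮 : Finset (Finset V)}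
    (h𝒮 : ∀ S ∈ 𝒮, S.card ≤ q ∧ IsSpreadCore R F S) (hR : 0 < R)
    (hq : 2 * ((s : ℝ) * q) ≤ R) (hkj : k < 2 ^ j) (hL : 4 ^ j * s < 2 ^ L)
    (hRL : 64 * ((s : ℝ) * L) ≤ R / 2) : CoresAtLeast s t 𝒮 := by
  intro S hS K hK
  by_contra! hKt
  choose H hHF hHne hSH hspread using fun i => (h𝒮 (S i) (hS i)).2
  set U := univ.biUnion S with hU
  have hUcard : U.card ≤ s * q := by
    refine card_biUnion_le.trans ((sum_le_sum fun i _ => (h𝒮 _ (hS i)).1).trans ?_)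
    simp
  have hhalf : ∀ i, ((H i).card : ℝ) ≤ 2 * ((H i).filter (· ∩ U ⊆ S i)).card := fun i =>
    card_le_two_mul_card_filter_inter_subset hR (hspread i) (by
      have : (U.card : ℝ) ≤ s * q := by exact_mod_cast hUcard
      linarith)
  -- Members meeting the union of the cores only inside their own core.
  set H' : Fin s → Finset (Finset V) := fun i => (H i).filter (· ∩ U ⊆ S i) with hH'
  have hpos : ∀ i, (0 : ℝ) < (H i).card := fun i => by exact_mod_cast (hHne i).card_pos
  have hfilter : ∀ i, (H' i).filter (S i ⊆ ·) = H' i := fun i =>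
    filter_true_of_mem fun A hA => hSH i A (mem_filter.1 hA).1
  obtain ⟨B, hB, hdisj⟩ := exists_disjoint_representatives (R := R / 2) (j := j) (L := L)
    (by omega) (fun i => link (H' i) (S i)) (fun i => by
      rw [← card_pos, card_link, hfilter]
      have h1 := hhalf i
      have h2 := hpos i
      have : (0 : ℝ) < (H' i).card := by linarith
      exact_mod_cast this) (fun i => by
      refine isSpread_link _ _ fun X hX => ?_
      rw [hfilter]
      rcases X.eq_empty_or_nonempty with rfl | hne
      · simp only [card_empty, pow_zero, one_mul, empty_union]
        rw [hfilter]
      · have h1 : ((H' i).filter (X ∪ S i ⊆ ·)).card ≤ ((H i).filter (X ⊆ ·)).card := by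
          refine card_le_card fun A hA => ?_
          simp only [hH', mem_filter] at hA ⊢
          exact ⟨hA.1.1, subset_union_left.trans hA.2⟩
        -- The factor lost in passing to half of `H i` is absorbed by halving `R`, as `X` is
        -- nonempty.
        have h2 : (2 : ℝ) ≤ 2 ^ X.card := by
          calc (2 : ℝ) = 2 ^ 1 := by norm_num
            _ ≤ 2 ^ X.card := pow_le_pow_right₀ (by norm_num) hne.card_pos
        have h3 : 2 * ((R / 2) ^ X.card * (((H' i).filter (X ∪ S i ⊆ ·)).card : ℝ)) ≤
            2 * (H' i).card := by
          calc 2 * ((R / 2) ^ X.card * (((H' i).filter (X ∪ S i ⊆ ·)).card : ℝ))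
              ≤ 2 ^ X.card * ((R / 2) ^ X.card * (((H i).filter (X ⊆ ·)).card : ℝ)) := by
                gcongr
            _ = R ^ X.card * (((H i).filter (X ⊆ ·)).card : ℝ) := by
                rw [← mul_assoc, ← mul_pow]
                congr 2
                ring
            _ ≤ (H i).card := hspread i X hX
            _ ≤ _ := hhalf i
        linarith) hRL (fun i B hB => by
      obtain ⟨A, hA, rfl⟩ := mem_image.1 hB
      have hA' := hF A (hHF i (mem_filter.1 (mem_filter.1 hA).1).1)
      exact (card_le_card sdiff_subset).trans_lt (hA' ▸ hkj)) hL
  choose A hA hAB using fun i => mem_image.1 (hB i)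
  have hAH : ∀ i, A i ∈ H i := fun i => (mem_filter.1 (mem_filter.1 (hA i)).1).1
  have hAU : ∀ i, A i ∩ U ⊆ S i := fun i => (mem_filter.1 (mem_filter.1 (hA i)).1).2
  have hmem : ∀ i j x, i ≠ j → x ∈ A i → x ∈ A j → x ∈ S i := by
    intro i j x hij hi hj
    by_contra hxi
    have hxU : x ∉ U := fun h => hxi (hAU i (mem_inter.2 ⟨hi, h⟩))
    have hxj : x ∉ S j := fun h => hxU (mem_biUnion.2 ⟨j, mem_univ _, h⟩)
    refine Finset.disjoint_left.1 (hdisj i j hij) (?_ : x ∈ B i) ?_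
    · rw [← hAB]; exact mem_sdiff.2 ⟨hi, hxi⟩
    · rw [← hAB]; exact mem_sdiff.2 ⟨hj, hxj⟩
  refine hfree (containsSunflowerWithCoreLE_of_pairwise_inter hs
    (fun i => hHF i (hAH i)) (K := K) (fun i j hij => ?_) (fun i h => ?_) (by omega))
  · rw [← hK i j hij]
    ext x
    simp only [mem_inter]
    exact ⟨fun h => ⟨hmem i j x hij h.1 h.2, hmem j i x hij.symm h.2 h.1⟩,
      fun h => ⟨hSH i _ (hAH i) h.1, hSH j _ (hAH j) h.2⟩⟩
  -- No `A i` equals `K`, since `|A i| = k ≥ t > |K|`; this makes the petals distinct.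
  · have := hF _ (hHF i (hAH i))
    rw [h] at this
    omega

end

/-! ### Irreducible families -/

section

variable {V : Type*} [DecidableEq V] [Fintype V]

/-- Below every family with large cores there is one in which no member can be shrunk. -/
theorem exists_irreducible_coresAtLeast {s t : ℕ} {𝒮 : Finset (Finset V)}
    (h𝒮 : CoresAtLeast s t 𝒮) :
    ∃ 𝒯 : Finset (Finset V), CoresAtLeast s t 𝒯 ∧ (∀ S ∈ 𝒮, ∃ T ∈ 𝒯, T ⊆ S) ∧
      (∀ T ∈ 𝒯, ∃ S ∈ 𝒮, T ⊆ S) ∧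
      ∀ X, ∀ T ∈ 𝒯, X ⊂ T → ¬ CoresAtLeast s t (insert X (𝒯.filter (¬ X ⊆ ·))) := by
  classical
  obtain ⟨𝒯, h𝒯, hmin⟩ := exists_min_image (univ.filter fun 𝒯 : Finset (Finset V) =>
    CoresAtLeast s t 𝒯 ∧ (∀ S ∈ 𝒮, ∃ T ∈ 𝒯, T ⊆ S) ∧ ∀ T ∈ 𝒯, ∃ S ∈ 𝒮, T ⊆ S)
    (fun 𝒯 => ∑ T ∈ 𝒯, (T.card + 1))
    ⟨𝒮, by
      simp only [mem_filter, mem_univ, true_and]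
      exact ⟨h𝒮, fun S hS => ⟨S, hS, Subset.rfl⟩, fun S hS => ⟨S, hS, Subset.rfl⟩⟩⟩
  simp only [mem_filter, mem_univ, true_and] at h𝒯 hmin
  obtain ⟨hcore, hbelow, habove⟩ := h𝒯
  refine ⟨𝒯, hcore, hbelow, habove, fun X T hT hXT hX => ?_⟩
  have h1 := hmin _ ⟨hX, fun S hS => ?_, fun T' hT' => ?_⟩
  · have h2 : ∑ T' ∈ insert X (𝒯.filter (¬ X ⊆ ·)), (T'.card + 1) =
        X.card + 1 + ∑ T' ∈ 𝒯.filter (¬ X ⊆ ·), (T'.card + 1) :=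
      sum_insert (by simp)
    have h3 := sum_filter_add_sum_filter_not 𝒯 (X ⊆ ·) (fun T' => T'.card + 1)
    have h4 : T.card + 1 ≤ ∑ T' ∈ 𝒯.filter (X ⊆ ·), (T'.card + 1) :=
      single_le_sum (f := fun T' : Finset V => T'.card + 1) (fun _ _ => Nat.zero_le _)
        (mem_filter.2 ⟨hT, hXT.1⟩)
    have h5 := card_lt_card hXT
    omega
  · obtain ⟨T', hT', hsub⟩ := hbelow S hS
    by_cases hXT' : X ⊆ T'
    · exact ⟨X, mem_insert_self _ _, hXT'.trans hsub⟩
    · exact ⟨T', mem_insert_of_mem (mem_filter.2 ⟨hT', hXT'⟩), hsub⟩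
  · rcases mem_insert.1 hT' with rfl | hT'
    · obtain ⟨S, hS, hTS⟩ := habove T hT
      exact ⟨S, hS, hXT.1.trans hTS⟩
    · exact habove T' (mem_filter.1 hT').1

/-- Replacing by `X` all members above it creates sets with a small common intersection, one of
which is `X`. If `X` had too many supersets, one of them would meet the other sets only inside `X`
and could take its place, contradicting `hcore`. -/
theorem degree_le_of_irreducible {s t q : ℕ} {β : ℝ} (hβ : 0 < β) (hsq : (s : ℝ) * q ≤ β)
    {𝒯 : Finset (Finset V)} (hcore : CoresAtLeast s t 𝒯) (hq : ∀ T ∈ 𝒯, T.card ≤ q)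
    (hirr : ∀ X, ∀ T ∈ 𝒯, X ⊂ T → ¬ CoresAtLeast s t (insert X (𝒯.filter (¬ X ⊆ ·)))) (m : ℕ) :
    ∀ X : Finset V, t ≤ X.card →
      (((𝒯.filter (·.card = X.card + m)).filter (X ⊆ ·)).card : ℝ) ≤ β ^ m := by
  induction m with
  | zero =>
    intro X _
    rw [pow_zero]
    have : (𝒯.filter (·.card = X.card + 0)).filter (X ⊆ ·) ⊆ {X} := by
      intro T hT
      simp only [mem_filter, add_zero] at hT
      rw [mem_singleton]
      exact (eq_of_subset_of_card_le hT.2 hT.1.2.le).symm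
    exact_mod_cast card_le_card this
  | succ m ih =>
    intro X hX
    by_contra! hlt
    set 𝒢 := (𝒯.filter (·.card = X.card + (m + 1))).filter (X ⊆ ·) with h𝒢
    have hins : ∀ y ∉ X, ((𝒢.filter (y ∈ ·)).card : ℝ) ≤ β ^ m := by
      intro y hy
      have h1 := ih (insert y X) (hX.trans (card_le_card (subset_insert _ _)))
      rw [card_insert_of_notMem hy] at h1
      refine le_trans ?_ h1
      have : 𝒢.filter (y ∈ ·) ⊆
          (𝒯.filter (·.card = X.card + 1 + m)).filter (insert y X ⊆ ·) := by
        intro T hT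
        simp only [h𝒢, mem_filter, insert_subset_iff] at hT ⊢
        exact ⟨⟨hT.1.1.1, by omega⟩, hT.2, hT.1.2⟩
      exact_mod_cast card_le_card this
    have h𝒢ne : 𝒢.Nonempty := by
      rw [← card_pos]
      have : (0 : ℝ) < 𝒢.card := lt_trans (by positivity) hlt
      exact_mod_cast this
    obtain ⟨T₀, hT₀⟩ := h𝒢ne
    simp only [h𝒢, mem_filter] at hT₀
    have hXT₀ : X ⊂ T₀ := by
      refine ssubset_of_subset_of_ne hT₀.2 fun h => ?_
      have := hT₀.1.2
      rw [← h] at this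
      omega
    have hnot := hirr X T₀ hT₀.1.1 hXT₀
    unfold CoresAtLeast at hnot
    push Not at hnot
    obtain ⟨S, hS, K, hK, hKt⟩ := hnot
    have hmem : ∀ i, S i ≠ X → S i ∈ 𝒯 := fun i hi =>
      (mem_filter.1 ((mem_insert.1 (hS i)).resolve_left hi)).1
    by_cases hex : ∃ i, S i = X
    · obtain ⟨i₀, hi₀⟩ := hex
      have huniq : ∀ i, i ≠ i₀ → S i ∈ 𝒯 := by
        -- A second occurrence of `X` would give `K = X`, which has at least `t` elements.
        intro i hi
        refine hmem i fun h => ?_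
        have := hK i i₀ hi
        rw [h, hi₀, inter_self] at this
        rw [this] at hX
        omega
      set U := (univ.erase i₀).biUnion S with hU
      have hUcard : (U.card : ℝ) ≤ s * q := by
        have h1 : U.card ≤ (univ.erase i₀).card * q := by
          refine card_biUnion_le.trans ((sum_le_sum fun i hi =>
            hq _ (huniq i (ne_of_mem_erase hi))).trans ?_)
          simp
        have h2 : (univ.erase i₀).card ≤ s := by simp
        exact_mod_cast h1.trans (Nat.mul_le_mul_right q h2)
      obtain ⟨T, hT, hTU⟩ : ∃ T ∈ 𝒢, T ∩ U ⊆ X := by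
        by_contra! hall
        have hsub : 𝒢 ⊆ (U \ X).biUnion (fun y => 𝒢.filter (y ∈ ·)) := by
          intro T hT
          obtain ⟨y, hy, hyX⟩ := not_subset.1 (hall T hT)
          rw [mem_inter] at hy
          exact mem_biUnion.2 ⟨y, mem_sdiff.2 ⟨hy.2, hyX⟩, mem_filter.2 ⟨hT, hy.1⟩⟩
        have h1 : (𝒢.card : ℝ) ≤ ∑ y ∈ U \ X, ((𝒢.filter (y ∈ ·)).card : ℝ) := by
          exact_mod_cast (card_le_card hsub).trans card_biUnion_le
        have h2 : (𝒢.card : ℝ) ≤ β ^ (m + 1) := by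
          calc (𝒢.card : ℝ) ≤ ∑ y ∈ U \ X, ((𝒢.filter (y ∈ ·)).card : ℝ) := h1
            _ ≤ ∑ y ∈ U \ X, β ^ m := sum_le_sum fun y hy => hins y (mem_sdiff.1 hy).2
            _ = (U \ X).card * β ^ m := by simp
            _ ≤ U.card * β ^ m := by gcongr; exact sdiff_subset
            _ ≤ β * β ^ m := by gcongr; exact hUcard.trans hsq
            _ = β ^ (m + 1) := by ring
        linarith
      simp only [h𝒢, mem_filter] at hT
      have hTS : ∀ i, i ≠ i₀ → T ∩ S i = K := by
        intro i hi
        rw [← hK i₀ i hi.symm, hi₀]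
        refine Subset.antisymm (fun x hx => ?_) (inter_subset_inter_right hT.2)
        rw [mem_inter] at hx ⊢
        exact ⟨hTU (mem_inter.2 ⟨hx.1, mem_biUnion.2 ⟨i, by simp [hi], hx.2⟩⟩), hx.2⟩
      have := hcore (Function.update S i₀ T) (fun i => ?_) K (fun i j hij => ?_)
      · omega
      · by_cases hi : i = i₀
        · subst hi; simpa using hT.1.1
        · simpa [hi] using huniq i hi
      · by_cases hi : i = i₀
        · subst hi
          simpa [hij.symm] using hTS j hij.symm
        · by_cases hj : j = i₀
          · subst hj
            simpa [hi, inter_comm] using hTS i hi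
          · simpa [hi, hj] using hK i j hij
    · have := hcore S (fun i => hmem i fun h => hex ⟨i, h⟩) K hK
      omega

/-- The number of `h`-element members of an irreducible family. -/
theorem card_filter_card_le_of_irreducible {s t q h j L : ℕ} {α β : ℝ} (hs : 0 < s) (hα : 0 < α)
    (hαβ : α ≤ β) (hsq : (s : ℝ) * q ≤ β)
    {𝒯 : Finset (Finset V)} (hcore : CoresAtLeast s t 𝒯) (hq : ∀ T ∈ 𝒯, T.card ≤ q)
    (hirr : ∀ X, ∀ T ∈ 𝒯, X ⊂ T → ¬ CoresAtLeast s t (insert X (𝒯.filter (¬ X ⊆ ·))))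
    (hj : h < 2 ^ j) (hL : 2 * 4 ^ j ≤ 2 ^ L) (hLα : 128 * ((s : ℝ) * L) ≤ α) :
    ((𝒯.filter (·.card = h)).card : ℝ) ≤ α ^ t * β ^ (h - t) := by
  have hβ : 0 < β := hα.trans_le hαβ
  rcases (𝒯.filter (·.card = h)).eq_empty_or_nonempty with hemp | hne
  · rw [hemp, card_empty, Nat.cast_zero]; positivity
  obtain ⟨Y, hY, ⟨T₀, hT₀⟩, hspread⟩ := exists_spread_link hα hne
  obtain ⟨hT₀, hYT₀⟩ := mem_filter.1 hT₀
  have hYh : Y.card ≤ h := (mem_filter.1 hT₀).2 ▸ card_le_card hYT₀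
  by_cases hYt : t ≤ Y.card
  · have h1 := degree_le_of_irreducible hβ hsq hcore hq hirr (h - Y.card) Y hYt
    rw [Nat.add_sub_cancel' hYh] at h1
    calc ((𝒯.filter (·.card = h)).card : ℝ) ≤ _ := hY
      _ ≤ α ^ Y.card * β ^ (h - Y.card) := by gcongr
      _ = α ^ t * α ^ (Y.card - t) * β ^ (h - Y.card) := by
        rw [← pow_add, Nat.add_sub_cancel' hYt]
      _ ≤ α ^ t * β ^ (Y.card - t) * β ^ (h - Y.card) := by gcongr
      _ = α ^ t * β ^ (h - t) := by
        rw [mul_assoc, ← pow_add]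
        congr 2
        omega
  -- If `|Y| < t`, disjoint members of the spread link give sets meeting pairwise in `Y`. They need
  -- not be distinct, as `CoresAtLeast` allows repetitions.
  · exfalso
    obtain ⟨B, hB, hdisj⟩ := exists_disjoint_members (R := α) (j := j) (L := L) hs
      (link (𝒯.filter (·.card = h)) Y) ⟨T₀ \ Y, mem_image_of_mem _ (mem_filter.2 ⟨hT₀, hYT₀⟩)⟩
      (isSpread_link _ _ fun X hX => by
        refine le_trans (le_of_eq ?_) (hspread X hX)
        congr 3
        rw [filter_filter]
        ext A
        simp only [mem_filter, union_subset_iff]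
        tauto) hLα (fun S hS => by
        obtain ⟨A, hA, rfl⟩ := mem_image.1 hS
        have hA' := (mem_filter.1 (mem_filter.1 hA).1).2
        exact (card_le_card sdiff_subset).trans_lt (hA' ▸ hj)) hL
    choose A hA hAB using fun i => mem_image.1 (hB i)
    refine hYt (hcore A (fun i => (mem_filter.1 (mem_filter.1 (hA i)).1).1) Y fun i k hik => ?_)
    refine Subset.antisymm (fun x hx => ?_)
      (subset_inter (mem_filter.1 (hA i)).2 (mem_filter.1 (hA k)).2)
    rw [mem_inter] at hx
    by_contra hxY
    refine Finset.disjoint_left.1 (hdisj i k hik) (?_ : x ∈ B i) ?_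
    · rw [← hAB]; exact mem_sdiff.2 ⟨hx.1, hxY⟩
    · rw [← hAB]; exact mem_sdiff.2 ⟨hx.2, hxY⟩

theorem not_containsSunflower_of_coresAtLeast {s t : ℕ} (hs : 2 ≤ s) {𝒯 : Finset (Finset V)}
    (hcore : CoresAtLeast s t 𝒯) : ¬ ContainsSunflower (𝒯.filter (·.card = t)) s := by
  rintro ⟨P, hP, hPs, K, -, hK⟩
  obtain ⟨e⟩ : Nonempty (Fin s ≃ P) := ⟨(P.equivFinOfCardEq hPs).symm⟩
  have hinj : ∀ i j, i ≠ j → (e i : Finset V) ≠ e j := fun i j hij h =>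
    hij (e.injective (Subtype.ext h))
  have hmem : ∀ i, (e i : Finset V) ∈ 𝒯 ∧ (e i : Finset V).card = t := fun i =>
    mem_filter.1 (hP (e i).2)
  have hinter : ∀ i j, i ≠ j → (e i : Finset V) ∩ e j = K := fun i j hij =>
    hK _ (e i).2 _ (e j).2 (hinj i j hij)
  have ht := hcore (fun i => e i) (fun i => (hmem i).1) K hinter
  have h01 : (⟨0, by omega⟩ : Fin s) ≠ ⟨1, by omega⟩ := by simp
  have h0 : K = e ⟨0, by omega⟩ := by
    refine eq_of_subset_of_card_le ?_ ((hmem _).2.trans_le ht)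
    rw [← hinter _ _ h01]; exact inter_subset_left
  have h1 : K = e ⟨1, by omega⟩ := by
    refine eq_of_subset_of_card_le ?_ ((hmem _).2.trans_le ht)
    rw [← hinter _ _ h01]; exact inter_subset_right
  exact hinj _ _ h01 (h0.symm.trans h1)

end

/-! ### Numerical estimates and counting -/

section

theorem one_le_logb_two {m : ℕ} (hm : 2 ≤ m) : 1 ≤ Real.logb 2 m := by
  rw [Real.le_logb_iff_rpow_le (by norm_num) (by positivity), Real.rpow_one]
  exact_mod_cast hm

theorem logb_two_le_self (m : ℕ) : Real.logb 2 m ≤ m := by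
  rcases Nat.eq_zero_or_pos m with rfl | hm
  · simp
  rw [Real.logb_le_iff_le_rpow (by norm_num) (by exact_mod_cast hm), Real.rpow_natCast]
  exact_mod_cast m.lt_two_pow_self.le

/-- `log₂ (t + i) ≤ log₂ t * exp (2 i / t)`, and the `t`-th power of the exponential is `exp 2 ^ i ≤
8 ^ i`. -/
theorem logb_two_add_pow_le {t : ℕ} (ht : 2 ≤ t) (i : ℕ) :
    Real.logb 2 ((t + i : ℕ) : ℝ) ^ t ≤ Real.logb 2 t ^ t * 8 ^ i := by
  have ht0 : (0 : ℝ) < t := by positivity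
  have hlt := one_le_logb_two ht
  have hlog2 : (1 / 2 : ℝ) < Real.log 2 := by linarith [Real.log_two_gt_d9]
  have hx : (0 : ℝ) ≤ (i : ℝ) / t := by positivity
  have h1 : Real.logb 2 ((t + i : ℕ) : ℝ) = Real.logb 2 t + Real.logb 2 (1 + i / t) := by
    rw [← Real.logb_mul ht0.ne' (by positivity)]
    congr 1
    push_cast
    field_simp
  have h2 : Real.logb 2 (1 + i / t) ≤ 2 * (i / t) := by
    unfold Real.logb
    rw [div_le_iff₀ (by linarith)]
    have := Real.log_le_sub_one_of_pos (show (0 : ℝ) < 1 + i / t by positivity)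
    nlinarith
  have h3 : Real.logb 2 ((t + i : ℕ) : ℝ) ≤ Real.logb 2 t * Real.exp (2 * (i / t)) := by
    have := Real.add_one_le_exp (2 * ((i : ℝ) / t))
    rw [h1]
    nlinarith
  have h4 : Real.exp (2 * ((i : ℝ) / t)) ^ t = Real.exp 2 ^ i := by
    rw [← Real.exp_nat_mul, ← Real.exp_nat_mul]
    congr 1
    field_simp
  have h5 : Real.exp 2 ≤ 8 := by
    have h := Real.exp_one_lt_d9
    have h' : Real.exp 2 = Real.exp 1 * Real.exp 1 := by rw [← Real.exp_add]; norm_num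
    rw [h']
    nlinarith [Real.exp_pos 1]
  have h0 : 0 ≤ Real.logb 2 ((t + i : ℕ) : ℝ) := by
    have := one_le_logb_two (show 2 ≤ t + i by omega)
    linarith
  calc Real.logb 2 ((t + i : ℕ) : ℝ) ^ t ≤ (Real.logb 2 t * Real.exp (2 * (i / t))) ^ t := by
        gcongr
    _ = Real.logb 2 t ^ t * Real.exp 2 ^ i := by rw [mul_pow, h4]
    _ ≤ _ := by gcongr

theorem sum_range_pow_succ_le {z : ℝ} (hz : 0 ≤ z) (hz' : z ≤ 1 / 2) (m : ℕ) :
    ∑ i ∈ range m, z ^ (i + 1) ≤ 2 * z := by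
  have h : ∑ i ∈ range m, z ^ (i + 1) ≤ 2 * z * (1 - (1 / 2) ^ m) := by
    induction m with
    | zero => simp
    | succ m ih =>
      have h1 : z ^ (m + 1) ≤ z * (1 / 2) ^ m := by
        rw [pow_succ']
        gcongr
      rw [sum_range_succ, pow_succ (1 / 2 : ℝ)]
      linarith
  refine h.trans ?_
  have : (0 : ℝ) ≤ (1 / 2) ^ m := by positivity
  nlinarith

variable {V : Type*} [DecidableEq V]

theorem maxLink_mono [Fintype V] (C : PreAbstractSimplicialComplex V) (t : ℕ)
    {𝒜 ℬ : Finset (Finset V)} (h : 𝒜 ⊆ ℬ) : maxLink C t 𝒜 ≤ maxLink C t ℬ := by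
  refine sup_mono_fun fun T _ => ?_
  rw [card_link, card_link]
  exact card_le_card (filter_subset_filter _ h)

/-- The parameter inequalities behind the spread approximation. -/
theorem parameter_bounds {n s k t : ℕ} (hs : 2 ≤ s) (ht : 2 ≤ t) (hkt : t ≤ k)
    (hn₁ : (n : ℝ) / k ≥ 2 ^ 18 * s * (t + 1) * Real.logb 2 ((n : ℝ) / k))
    (hn₂ : (n : ℝ) ≥ 2 ^ 15 * s * k * Real.logb 2 k) :
    1 ≤ Real.logb 2 ((n : ℝ) / k) ∧ 0 < (n : ℝ) / k ∧
      256 * ((s : ℝ) * (2 * (Nat.log 2 k + 1) + Nat.log 2 s + 1 : ℕ)) ≤ (n : ℝ) / k := by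
  set ρ : ℝ := (n : ℝ) / k with hρ
  have hk : (0 : ℝ) < k := by exact_mod_cast (by omega : 0 < k)
  have hs' : (2 : ℝ) ≤ s := by exact_mod_cast hs
  have ht' : (2 : ℝ) ≤ t := by exact_mod_cast ht
  have hlk := one_le_logb_two (ht.trans hkt)
  have hρ₂ : 2 ^ 15 * (s * Real.logb 2 k) ≤ ρ := by
    rw [hρ, le_div_iff₀ hk]
    linarith
  have hρ2 : 2 ≤ ρ := by nlinarith
  have hρ0 : 0 < ρ := by linarith
  have hℓ : 1 ≤ Real.logb 2 ρ := by
    rw [Real.le_logb_iff_rpow_le (by norm_num) hρ0, Real.rpow_one]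
    exact hρ2
  have hsℓ : 2 ^ 18 * (s * Real.logb 2 ρ) ≤ ρ := by
    have : 0 ≤ (s : ℝ) * Real.logb 2 ρ := by positivity
    nlinarith
  have hsρ : 2 ^ 18 * (s : ℝ) ≤ ρ := by nlinarith
  have hls : Real.logb 2 s ≤ Real.logb 2 ρ :=
    Real.logb_le_logb_of_le (by norm_num) (by linarith) (by linarith)
  have h1 : (Nat.log 2 k : ℝ) ≤ Real.logb 2 k := by
    simpa using Real.natLog_le_logb k 2
  have h2 : (Nat.log 2 s : ℝ) ≤ Real.logb 2 ρ := by
    refine le_trans ?_ hls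
    simpa using Real.natLog_le_logb s 2
  refine ⟨hℓ, hρ0, ?_⟩
  push_cast
  have h3 := mul_le_mul_of_nonneg_left h1 (by linarith : (0 : ℝ) ≤ s)
  have h4 := mul_le_mul_of_nonneg_left h2 (by linarith : (0 : ℝ) ≤ s)
  linarith

/-- A remainder that is dense in the link of a large set is small. -/
theorem mul_card_le_of_dense_link [Fintype V] {C : PreAbstractSimplicialComplex V} {n k t q : ℕ}
    (hrank : RankAtLeast C n) (hk : 0 < k) (ht : 0 < t) (hρ : 0 < (n : ℝ) / k)
    (hℓ : 1 ≤ Real.logb 2 ((n : ℝ) / k))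
    (hq : ((t : ℝ) + 1) * Real.logb 2 ((n : ℝ) / k) < (q : ℝ) + 1)
    {F' : Finset (Finset V)} (hF' : F' ⊆ layer C k) {Y : Finset V} (hY : q < Y.card)
    (h : (F'.card : ℝ) ≤ ((n : ℝ) / k / 2) ^ Y.card * ((F'.filter (Y ⊆ ·)).card : ℝ)) :
    (n : ℝ) / k * F'.card ≤ maxLink C t (layer C k) := by
  set ρ : ℝ := (n : ℝ) / k with hρdef
  have hYq : (q : ℝ) + 1 ≤ Y.card := by exact_mod_cast hY
  have htY : t ≤ Y.card := by
    have : (t : ℝ) ≤ Y.card := by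
      have : (0 : ℝ) ≤ t := by positivity
      nlinarith
    exact_mod_cast this
  have hdeg := pow_mul_degree_le_maxLink hrank hk ht htY
  rw [← hρdef] at hdeg
  have hsub : ((F'.filter (Y ⊆ ·)).card : ℝ) ≤ ((layer C k).filter (Y ⊆ ·)).card := by
    exact_mod_cast card_le_card (filter_subset_filter _ hF')
  -- `|Y|` exceeds `(t + 1) log₂ ρ`. The gain `2 ^ |Y|` from using spread `ρ / 2` rather than `ρ`
  -- thus beats `ρ ^ (t + 1)`.
  have hpow : ρ ^ (t + 1) ≤ 2 ^ Y.card := by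
    have h1 : ρ = (2 : ℝ) ^ Real.logb 2 ρ :=
      (Real.rpow_logb (by norm_num) (by norm_num) hρ).symm
    have h2 : ρ ^ (t + 1) = (2 : ℝ) ^ (Real.logb 2 ρ * (t + 1 : ℕ)) := by
      rw [Real.rpow_mul (by norm_num), ← h1, Real.rpow_natCast]
    rw [h2, ← Real.rpow_natCast]
    refine Real.rpow_le_rpow_of_exponent_le (by norm_num) ?_
    push_cast
    linarith
  have h2 : (0 : ℝ) < 2 ^ Y.card := by positivity
  refine le_of_mul_le_mul_left ?_ h2
  calc (2 : ℝ) ^ Y.card * (ρ * F'.card)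
      ≤ 2 ^ Y.card * (ρ * ((ρ / 2) ^ Y.card * ((layer C k).filter (Y ⊆ ·)).card)) := by
        gcongr
        exact h.trans (by gcongr)
    _ = ρ * ρ ^ Y.card * ((layer C k).filter (Y ⊆ ·)).card := by
        rw [div_pow]
        field_simp
    _ = ρ ^ (t + 1) * (ρ ^ (Y.card - t) * ((layer C k).filter (Y ⊆ ·)).card) := by
        rw [← mul_assoc, ← pow_add, ← pow_succ']
        congr 2
        omega
    _ ≤ 2 ^ Y.card * maxLink C t (layer C k) := by gcongr

/-- The number of faces above the members of size larger than `t` of an irreducible family. -/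
theorem card_above_irreducible_le [Fintype V] {C : PreAbstractSimplicialComplex V}
    {n s k t q : ℕ} (hrank : RankAtLeast C n) (hk : 0 < k) (hs : 2 ≤ s) (ht : 2 ≤ t)
    (hρ : 0 < (n : ℝ) / k) {w : ℝ} (hqw : (q : ℝ) ≤ w)
    (hw : 2 ^ 18 * ((s : ℝ) * w) ≤ (n : ℝ) / k)
    {𝒯 : Finset (Finset V)} (hcore : CoresAtLeast s t 𝒯) (hq : ∀ T ∈ 𝒯, T.card ≤ q)
    (hirr : ∀ X, ∀ T ∈ 𝒯, X ⊂ T → ¬ CoresAtLeast s t (insert X (𝒯.filter (¬ X ⊆ ·)))) :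
    ((((range (q - t)).biUnion fun i => (𝒯.filter (·.card = t + (i + 1))).biUnion
      fun T => (layer C k).filter (T ⊆ ·)).card : ℕ) : ℝ) ≤
      (2 ^ 13 * s * Real.logb 2 t) ^ t * (2 ^ 18 * (s * w) / ((n : ℝ) / k)) *
        maxLink C t (layer C k) := by
  set ρ : ℝ := (n : ℝ) / k with hρdef
  set M : ℝ := (maxLink C t (layer C k) : ℝ) with hM
  have hM0 : 0 ≤ M := by positivity
  have hs' : (2 : ℝ) ≤ s := by exact_mod_cast hs
  have hw0 : 0 ≤ w := le_trans (by positivity) hqw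
  have hlt := one_le_logb_two ht
  have hlayer : ∀ i ∈ range (q - t), (((𝒯.filter (·.card = t + (i + 1))).biUnion
      fun T => (layer C k).filter (T ⊆ ·)).card : ℝ) ≤
      (2 ^ 13 * s * Real.logb 2 t) ^ t * (2 ^ 17 * (s * w) / ρ) ^ (i + 1) * M := by
    intro i hi
    rw [mem_range] at hi
    have hlh := one_le_logb_two (show 2 ≤ t + (i + 1) by omega)
    have hhq : ((t + (i + 1) : ℕ) : ℝ) ≤ q := by exact_mod_cast (by omega : t + (i + 1) ≤ q)
    have hcount : ((𝒯.filter (·.card = t + (i + 1))).card : ℝ) ≤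
        (2 ^ 13 * s * Real.logb 2 (t + (i + 1) : ℕ)) ^ t * (2 ^ 14 * (s * w)) ^ (i + 1) := by
      have := card_filter_card_le_of_irreducible (α := 2 ^ 13 * s * Real.logb 2 (t + (i + 1) : ℕ))
        (β := 2 ^ 14 * (s * w)) (j := Nat.log 2 (t + (i + 1)) + 1)
        (L := 2 * (Nat.log 2 (t + (i + 1)) + 1) + 1) (h := t + (i + 1)) (q := q) (s := s)
        (by omega) (by positivity) ?_ ?_ hcore hq hirr
        (Nat.lt_pow_succ_log_self (by norm_num) _) ?_ ?_
      · rwa [Nat.add_sub_cancel_left] at this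
      -- `α ≤ β`, because `log₂ h ≤ h ≤ q ≤ w` for `h = t + (i + 1)`.
      · have h1 := logb_two_le_self (t + (i + 1))
        have h2 : (s : ℝ) * Real.logb 2 (t + (i + 1) : ℕ) ≤ s * w := by gcongr; linarith
        have : 0 ≤ (s : ℝ) * w := by positivity
        nlinarith
      · have : (s : ℝ) * q ≤ s * w := by gcongr
        have : 0 ≤ (s : ℝ) * w := by positivity
        nlinarith
      · rw [pow_succ 2 (2 * _), pow_mul]
        norm_num [mul_comm]
      · have h1 : (Nat.log 2 (t + (i + 1)) : ℝ) ≤ Real.logb 2 (t + (i + 1) : ℕ) := by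
          simpa using Real.natLog_le_logb (t + (i + 1)) 2
        have h2 : ((2 * (Nat.log 2 (t + (i + 1)) + 1) + 1 : ℕ) : ℝ) ≤
            5 * Real.logb 2 (t + (i + 1) : ℕ) := by
          push_cast at h1 hlh ⊢
          linarith
        have h3 : (0 : ℝ) ≤ s * Real.logb 2 (t + (i + 1) : ℕ) := by positivity
        have h4 := mul_le_mul_of_nonneg_left h2 (by linarith : (0 : ℝ) ≤ s)
        nlinarith
    have hdeg : ∀ T ∈ 𝒯.filter (·.card = t + (i + 1)),
        (((layer C k).filter (T ⊆ ·)).card : ℝ) ≤ M / ρ ^ (i + 1) := by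
      intro T hT
      have hTc := (mem_filter.1 hT).2
      have := pow_mul_degree_le_maxLink hrank hk (by omega : 0 < t) (Y := T) (by omega)
      rw [hTc, Nat.add_sub_cancel_left] at this
      rw [le_div_iff₀ (by positivity)]
      linarith
    calc (((𝒯.filter (·.card = t + (i + 1))).biUnion
          fun T => (layer C k).filter (T ⊆ ·)).card : ℝ)
        ≤ ∑ T ∈ 𝒯.filter (·.card = t + (i + 1)), (((layer C k).filter (T ⊆ ·)).card : ℝ) := by
          exact_mod_cast card_biUnion_le
      _ ≤ ∑ T ∈ 𝒯.filter (·.card = t + (i + 1)), M / ρ ^ (i + 1) := sum_le_sum hdeg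
      _ = (𝒯.filter (·.card = t + (i + 1))).card * (M / ρ ^ (i + 1)) := by simp
      _ ≤ ((2 ^ 13 * s * Real.logb 2 (t + (i + 1) : ℕ)) ^ t * (2 ^ 14 * (s * w)) ^ (i + 1)) *
          (M / ρ ^ (i + 1)) := by gcongr
      _ = (2 ^ 13 * s) ^ t * Real.logb 2 (t + (i + 1) : ℕ) ^ t * (2 ^ 14 * (s * w)) ^ (i + 1) *
          (M / ρ ^ (i + 1)) := by rw [mul_pow]
      _ ≤ (2 ^ 13 * s) ^ t * (Real.logb 2 t ^ t * 8 ^ (i + 1)) * (2 ^ 14 * (s * w)) ^ (i + 1) *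
          (M / ρ ^ (i + 1)) := by
          gcongr
          exact logb_two_add_pow_le ht (i + 1)
      _ = (2 ^ 13 * s * Real.logb 2 t) ^ t * (2 ^ 17 * (s * w) / ρ) ^ (i + 1) * M := by
          rw [mul_pow (2 ^ 13 * (s : ℝ)), div_pow _ ρ,
            show (2 : ℝ) ^ 17 * (s * w) = 8 * (2 ^ 14 * (s * w)) by ring, mul_pow 8]
          ring
  -- The ratio `2 ^ 17` is the `2 ^ 14` of `β` times the `8` from the logarithms; summing the series
  -- doubles it to `2 ^ 18`.
  have hz : 2 ^ 17 * (s * w) / ρ ≤ 1 / 2 := by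
    rw [div_le_iff₀ hρ]
    linarith
  calc _ ≤ ∑ i ∈ range (q - t), (((𝒯.filter (·.card = t + (i + 1))).biUnion
      fun T => (layer C k).filter (T ⊆ ·)).card : ℝ) := by exact_mod_cast card_biUnion_le
    _ ≤ ∑ i ∈ range (q - t),
        (2 ^ 13 * s * Real.logb 2 t) ^ t * (2 ^ 17 * (s * w) / ρ) ^ (i + 1) * M :=
      sum_le_sum hlayer
    _ = (2 ^ 13 * s * Real.logb 2 t) ^ t *
        (∑ i ∈ range (q - t), (2 ^ 17 * (s * w) / ρ) ^ (i + 1)) * M := by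
      rw [mul_sum, sum_mul]
    _ ≤ (2 ^ 13 * s * Real.logb 2 t) ^ t * (2 * (2 ^ 17 * (s * w) / ρ)) * M := by
      gcongr
      exact sum_range_pow_succ_le (by positivity) hz _
    _ = _ := by ring

end

end SimplicialSunflower

/-! ### The main theorem -/

theorem mainTheorem8 {V : Type*} [Fintype V] [DecidableEq V]
    (C : PreAbstractSimplicialComplex V) (n s k t : ℕ)
    (hrank : SimplicialSunflower.RankAtLeast C n)
    (hs : 2 ≤ s) (ht : 2 ≤ t) (hkt : t ≤ k)
    (hn₁ : (n : ℝ) / k ≥ 2 ^ 18 * s * (t + 1) * Real.logb 2 ((n : ℝ) / k))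
    (hn₂ : (n : ℝ) ≥ 2 ^ 15 * s * k * Real.logb 2 k)
    (F : Finset (Finset V)) (hF : F ⊆ SimplicialSunflower.layer C k)
    (hfree : ¬ SimplicialSunflower.ContainsSunflowerWithCoreLE F s (t - 1)) :
    ∃ 𝒯 : Finset (Finset V), 𝒯 ⊆ SimplicialSunflower.layer C t ∧
      ¬ SimplicialSunflower.ContainsSunflower 𝒯 s ∧
      (((F \ SimplicialSunflower.containing F 𝒯).card : ℝ) ≤
        (2 ^ 14 * s * Real.logb 2 t) ^ t *
          (2 ^ 19 * s * (t + 1) * Real.logb 2 ((n : ℝ) / k) / ((n : ℝ) / k)) *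
          SimplicialSunflower.maxLink C t (SimplicialSunflower.layer C k)) ∧
      (((F \ SimplicialSunflower.containing F 𝒯).card : ℝ) ≤
        (2 ^ 14 * s * Real.logb 2 t) ^ t *
          (2 ^ 19 * s * (t + 1) * Real.logb 2 ((n : ℝ) / k) / ((n : ℝ) / k)) *
          SimplicialSunflower.maxLink C t (SimplicialSunflower.faceFamily C)) := by
  open SimplicialSunflower Finset in
  have hk : 0 < k := by omega
  obtain ⟨hℓ, hρ, hL⟩ := parameter_bounds hs ht hkt hn₁ hn₂
  have hs' : (2 : ℝ) ≤ s := by exact_mod_cast hs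
  have hlt := one_le_logb_two ht
  set ρ : ℝ := (n : ℝ) / k with hρdef
  set w : ℝ := ((t : ℝ) + 1) * Real.logb 2 ρ with hw
  have hw1 : 1 ≤ w := by
    have : (0 : ℝ) ≤ t := by positivity
    nlinarith
  have hsw : 2 ^ 18 * ((s : ℝ) * w) ≤ ρ := by rw [hw]; linarith
  have hsw1 : 1 ≤ (s : ℝ) * w := by nlinarith
  set q := ⌊w⌋₊ with hq
  have hqw : (q : ℝ) ≤ w := Nat.floor_le (by linarith)
  obtain ⟨𝒮, F', hF', hcov, hcores, hrem⟩ :=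
    exists_spread_approximation (show 0 < ρ / 2 by linarith) q F
  have h𝒮 : CoresAtLeast s t 𝒮 :=
    coresAtLeast_of_isSpreadCore (j := Nat.log 2 k + 1)
      (L := 2 * (Nat.log 2 k + 1) + Nat.log 2 s + 1) hs (by omega) hkt
      (fun A hA => (mem_layer.1 (hF hA)).2) hfree hcores (by linarith)
      (by
        have : (s : ℝ) * q ≤ s * w := by gcongr
        linarith)
      (Nat.lt_pow_succ_log_self (by norm_num) k)
      (by
        rw [add_assoc, pow_add 2, pow_mul]
        exact Nat.mul_lt_mul_of_pos_left (Nat.lt_pow_succ_log_self (by norm_num) s)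
          (by positivity))
      (by linarith)
  obtain ⟨𝒯, hcore, hbelow, habove, hirr⟩ := exists_irreducible_coresAtLeast h𝒮
  have h𝒯q : ∀ T ∈ 𝒯, T.card ≤ q := fun T hT => by
    obtain ⟨S, hS, hTS⟩ := habove T hT
    exact (card_le_card hTS).trans (hcores S hS).1
  -- The constant sequence `T` has pairwise intersection `T`, so `CoresAtLeast` bounds `|T|` itself.
  have h𝒯t : ∀ T ∈ 𝒯, t ≤ T.card := fun T hT =>
    hcore (fun _ => T) (fun _ => hT) T fun _ _ _ => inter_self T
  have hcover : F \ containing F (𝒯.filter (·.card = t)) ⊆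
      F' ∪ (range (q - t)).biUnion fun i => (𝒯.filter (·.card = t + (i + 1))).biUnion
        fun T => (layer C k).filter (T ⊆ ·) := by
    intro A hA
    obtain ⟨hAF, hAT⟩ := mem_sdiff.1 hA
    rw [mem_union]
    by_cases hAF' : A ∈ F'
    · exact Or.inl hAF'
    right
    obtain ⟨S, hS, hSA⟩ := hcov A hAF hAF'
    obtain ⟨T, hT, hTS⟩ := hbelow S hS
    have h1 := h𝒯t T hT
    have h2 := h𝒯q T hT
    have h3 : T.card ≠ t := fun h => hAT
      (mem_filter.2 ⟨hAF, T, mem_filter.2 ⟨hT, h⟩, hTS.trans hSA⟩)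
    refine mem_biUnion.2 ⟨T.card - t - 1, mem_range.2 (by omega), mem_biUnion.2 ⟨T, ?_, ?_⟩⟩
    · exact mem_filter.2 ⟨hT, by omega⟩
    · exact mem_filter.2 ⟨hF hAF, hTS.trans hSA⟩
  have hcard : ((F \ containing F (𝒯.filter (·.card = t))).card : ℝ) ≤
      (F'.card : ℝ) + (((range (q - t)).biUnion fun i =>
        (𝒯.filter (·.card = t + (i + 1))).biUnion
          fun T => (layer C k).filter (T ⊆ ·)).card : ℕ) := by
    exact_mod_cast (card_le_card hcover).trans (card_union_le _ _)
  have hmain : ((F \ containing F (𝒯.filter (·.card = t))).card : ℝ) ≤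
      (2 ^ 14 * s * Real.logb 2 t) ^ t *
        (2 ^ 19 * s * (t + 1) * Real.logb 2 ρ / ρ) * maxLink C t (layer C k) := by
    have hlarge := card_above_irreducible_le hrank hk hs ht hρ hqw hsw hcore h𝒯q hirr
    rw [← hρdef] at hlarge
    have hsmall : (F'.card : ℝ) ≤ 1 / ρ * maxLink C t (layer C k) := by
      rw [one_div, ← div_eq_inv_mul, le_div_iff₀ hρ, mul_comm]
      rcases hrem with rfl | ⟨Y, hY, hYF'⟩
      · simp
      · exact mul_card_le_of_dense_link hrank hk (by omega) hρ hℓ (Nat.lt_floor_add_one w)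
          (hF'.trans hF) hY hYF'
    have hM : (0 : ℝ) ≤ maxLink C t (layer C k) := by positivity
    have hP1 : (1 : ℝ) ≤ (2 ^ 14 * s * Real.logb 2 t) ^ t := by
      refine one_le_pow₀ ?_
      nlinarith
    have hP2 : (2 ^ 13 * s * Real.logb 2 t) ^ t ≤ (2 ^ 14 * s * Real.logb 2 t) ^ t := by
      gcongr
      · norm_num
      · norm_num
    -- The remainder costs no more than the bound for the large members; together they turn `2 ^ 18`
    -- into `2 ^ 19`.
    have hfirst : 1 / ρ ≤ (2 ^ 14 * s * Real.logb 2 t) ^ t * (2 ^ 18 * (s * w) / ρ) := by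
      rw [← mul_div_assoc]
      gcongr
      nlinarith
    calc _ ≤ _ := hcard
      _ ≤ 1 / ρ * maxLink C t (layer C k) + (2 ^ 13 * s * Real.logb 2 t) ^ t *
          (2 ^ 18 * (s * w) / ρ) * maxLink C t (layer C k) := add_le_add hsmall hlarge
      _ ≤ (2 ^ 14 * s * Real.logb 2 t) ^ t * (2 ^ 18 * (s * w) / ρ) *
            maxLink C t (layer C k) + (2 ^ 14 * s * Real.logb 2 t) ^ t *
          (2 ^ 18 * (s * w) / ρ) * maxLink C t (layer C k) := by gcongr
      _ = _ := by rw [hw]; ring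
  refine ⟨𝒯.filter (·.card = t), fun T hT => ?_,
    not_containsSunflower_of_coresAtLeast hs hcore, hmain, hmain.trans ?_⟩
  · obtain ⟨hT, hTt⟩ := mem_filter.1 hT
    obtain ⟨S, hS, hTS⟩ := habove T hT
    obtain ⟨H, hH, ⟨A, hA⟩, hSH, -⟩ := (hcores S hS).2
    refine mem_layer.2 ⟨mem_of_subset_of_mem (mem_layer.1 (hF (hH hA))).1
      (hTS.trans (hSH A hA)) (card_pos.1 (by omega)), hTt⟩
  · gcongr
    exact maxLink_mono C t (filter_subset _ _)
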